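/- Let $N>1$ be an integer, $p\ge 2$, $s\in(0,1)$, $N>ps$, and let $\Omega\subset\mathbb R^N$ be a bounded domain with $C^{1,1}$ boundary. Write $\Omega^c=\mathbb R^N\setminus\Omega$, $d\mu=|x-y|^{-N-ps}\,dx\,dy$ on $\mathbb R^N\times\mathbb R^N$, and $p_s^*=Np/(N-ps)$; pointwise relations between functions hold almost everywhere. For $U\subseteq\mathbb R^N$ open let $W^{s,p}(U)$ be the set of $u\in L^p(U)$ with $\iint_{U\times U}|u(x)-u(y)|^p\,d\mu<\infty$. Let $$W^{s,p}_0(\Omega)=\{u\in W^{s,p}(\mathbb R^N):\ u=0\text{ in }\Omega^c\},\qquad \|u\|_{s,p}=\Big(\iint_{\mathbb R^N\times\mathbb R^N}|u(x)-u(y)|^p\,d\mu\Big)^{1/p},$$ and let $\widetilde W^{s,p}(\Omega)$ be the set of all $u\in L^p_{\rm loc}(\mathbb R^N)$ such that $u\in W^{s,p}(U)$ for some open $U\supset\overline\Omega$ and $\int_{\mathbb R^N}\frac{|u(x)|^{p-1}}{(1+|x|)^{N+ps}}\,dx<\infty$. For $u\in\widetilde W^{s,p}(\Omega)$ and $v\in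 W^{s,p}_0(\Omega)$ put $$\langle(-\Delta)_p^s u,v\rangle=\iint_{\mathbb R^N\times\mathbb R^N}|u(x)-u(y)|^{p-2}(u(x)-u(y))(v(x)-v(y))\,d\mu.$$ Let $f:\Omega\times\mathbb R\to\mathbb R$ satisfy ${\bf H}_0$: $f$ is a Carathéodory function, and there are $c_0>0$ and $q\in(p,p_s^*)$ with $|f(x,t)|\le c_0(1+|t|^{q-1})$ for a.e. $x\in\Omega$ and all $t\in\mathbb R$. Consider the problem $$(P)\qquad (-\Delta)_p^s u=f(x,u)\ \text{in }\Omega,\qquad u=0\ \text{in }\Omega^c.$$ A function $u\in\widetilde W^{s,p}(\Omega)$ is a supersolution (respectively, a subsolution) of $(P)$ if $u\ge0$ (respectively, $u\le 0$) in $\Omega^c$ and $\langle(-\Delta)_p^s u,v\rangle\ge\int_\Omega f(x,u)v\,dx$ (respectively, $\le$) for all $v\in W^{s,p}_0(\Omega)$ with $v\ge0$; a function $u\in W^{s,p}_0(\Omega)$ is a solution of $(P)$ if $\langle(-\Delta)_p^s u,v\rangle=\int_\Omega f(x,u)v\,dx$ for all $v\in W^{s,p}_0(\Omega)$. A pair $(\underline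 u,\overline u)$ is a sub-supersolution pair of $(P)$ if $\underline u$ is a subsolution, $\overline u$ is a supersolution, and $\underline u\le\overline u$ in $\Omega$. Then for every sub-supersolution pair $(\underline u,\overline u)$ of $(P)$ the set $$\mathcal S(\underline u,\overline u)=\{u\in W^{s,p}_0(\Omega):\ u\text{ is a solution of }(P),\ \underline u\le u\le\overline u\text{ in }\Omega\}$$ is compact in $W^{s,p}_0(\Omega)$ with respect to the norm $\|\cdot\|_{s,p}$. -/

import Mathlib

open MeasureTheory Set
open scoped ENNReal NNReal

namespace FracPLap

noncomputable section

/-- `ℝ^N` with the Euclidean norm. -/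
abbrev E (N : ℕ) : Type := EuclideanSpace ℝ (Fin N)

/-- `C^{1,1}` boundary: near each of its boundary points, `Ω` is, in suitable orthonormal
coordinates (a unit vector `e` and the hyperplane orthogonal to it), the set of points strictly
below the graph of a `C^1` function with Lipschitz derivative. -/
def HasC11Boundary {N : ℕ} (Ω : Set (E N)) : Prop :=
  ∀ x₀ ∈ frontier Ω, ∃ e : E N, ‖e‖ = 1 ∧ ∃ r : ℝ, 0 < r ∧ ∃ φ : ((ℝ ∙ e)ᗮ : Submodule ℝ (E N)) → ℝ,
    ContDiff ℝ 1 φ ∧ (∃ L : ℝ≥0, LipschitzWith L (fderiv ℝ φ)) ∧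
    ∀ x ∈ Metric.ball x₀ r, (x ∈ Ω ↔ inner ℝ e x < φ ((ℝ ∙ e)ᗮ.orthogonalProjectionOnto x))

/-- The measure `dμ = |x - y|^{-N-ps} dx dy` on `ℝ^N × ℝ^N` (the diagonal is a null set). -/
def gagliardoMeasure (N : ℕ) (s p : ℝ) : Measure (E N × E N) :=
  (volume : Measure (E N × E N)).withDensity
    fun z => ENNReal.ofReal (‖z.1 - z.2‖ ^ (-((N : ℝ) + p * s)))

/-- The function `(x, y) ↦ u(x) - u(y)`. -/
def diff {N : ℕ} (u : E N → ℝ) : E N × E N → ℝ := fun z => u z.1 - u z.2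

/-- `u ∈ W^{s,p}(U)`: `u ∈ L^p(U)` and `∬_{U × U} |u(x) - u(y)|^p dμ < ∞`. -/
def MemW {N : ℕ} (s p : ℝ) (U : Set (E N)) (u : E N → ℝ) : Prop :=
  MemLp u (ENNReal.ofReal p) (volume.restrict U) ∧
    MemLp (diff u) (ENNReal.ofReal p) ((gagliardoMeasure N s p).restrict (U ×ˢ U))

lemma diff_congr {N : ℕ} (s p : ℝ) {u v : E N → ℝ} (h : u =ᵐ[volume] v) :
    diff u =ᵐ[gagliardoMeasure N s p] diff v := by
  refine (withDensity_absolutelyContinuous _ _).ae_le ?_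
  have h1 : ∀ᵐ z : E N × E N, u z.1 = v z.1 :=
    Measure.quasiMeasurePreserving_fst.ae h
  have h2 : ∀ᵐ z : E N × E N, u z.2 = v z.2 :=
    Measure.quasiMeasurePreserving_snd.ae h
  filter_upwards [h1, h2] with z hz1 hz2
  simp [diff, hz1, hz2]

/-- `W^{s,p}_0(Ω) = {u ∈ W^{s,p}(ℝ^N) : u = 0 a.e. in Ω^c}`, as a space of classes of functions
modulo equality almost everywhere. -/
def W0Submodule {N : ℕ} (Ω : Set (E N)) (s p : ℝ) :
    Submodule ℝ (Lp ℝ (ENNReal.ofReal p) (volume : Measure (E N))) where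
  carrier := {u | MemLp (diff u) (ENNReal.ofReal p) (gagliardoMeasure N s p) ∧
    ∀ᵐ x ∂volume.restrict Ωᶜ, u x = 0}
  zero_mem' := by
    have h := Lp.coeFn_zero ℝ (ENNReal.ofReal p) (volume : Measure (E N))
    refine ⟨?_, ?_⟩
    · refine MemLp.ae_eq (diff_congr s p h).symm ?_
      have : diff (0 : E N → ℝ) = 0 := by ext z; simp [diff]
      rw [this]
      exact MemLp.zero
    · exact ae_restrict_of_ae h
  add_mem' := by
    intro u v hu hv
    have h := Lp.coeFn_add u v
    refine ⟨?_, ?_⟩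
    · refine MemLp.ae_eq (diff_congr s p h).symm ?_
      have : diff (⇑u + ⇑v) = diff u + diff v := by ext z; simp [diff]; ring
      rw [this]
      exact hu.1.add hv.1
    · filter_upwards [ae_restrict_of_ae h, hu.2, hv.2] with x hx h1 h2
      rw [hx, Pi.add_apply, h1, h2, add_zero]
  smul_mem' := by
    intro c u hu
    have h := Lp.coeFn_smul c u
    refine ⟨?_, ?_⟩
    · refine MemLp.ae_eq (diff_congr s p h).symm ?_
      have : diff (c • ⇑u) = c • diff u := by ext z; simp [diff]; ring
      rw [this]
      exact hu.1.const_smul c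
    · filter_upwards [ae_restrict_of_ae h, hu.2] with x hx h1
      rw [hx, Pi.smul_apply, h1, smul_zero]

/-- The space `W^{s,p}_0(Ω)`, a type of its own so that it carries the norm `[u]_{s,p}` and not
the `L^p` norm. -/
def W0 {N : ℕ} (Ω : Set (E N)) (s p : ℝ) : Type := ↥(W0Submodule Ω s p)

namespace W0

variable {N : ℕ} {Ω : Set (E N)} {s p : ℝ}

instance : AddCommGroup (W0 Ω s p) := inferInstanceAs (AddCommGroup ↥(W0Submodule Ω s p))

instance : Module ℝ (W0 Ω s p) := inferInstanceAs (Module ℝ ↥(W0Submodule Ω s p))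

/-- A representative of the class `u`, defined on all of `ℝ^N`. -/
instance : CoeFun (W0 Ω s p) (fun _ => E N → ℝ) := ⟨fun u => ((u.1 : Lp ℝ _ _) : E N → ℝ)⟩

/-- The linear map `u ↦ u(x) - u(y)` from `W^{s,p}_0(Ω)` to `L^p(μ)`. -/
def toLp : W0 Ω s p →ₗ[ℝ] Lp ℝ (ENNReal.ofReal p) (gagliardoMeasure N s p) where
  toFun u := u.2.1.toLp
  map_add' u v := by
    rw [← MemLp.toLp_add, MemLp.toLp_eq_toLp_iff]
    refine (diff_congr s p (Lp.coeFn_add u.1 v.1)).trans (Filter.EventuallyEq.of_eq ?_)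
    ext z; simp [diff]; ring
  map_smul' c u := by
    rw [RingHom.id_apply, ← MemLp.toLp_const_smul, MemLp.toLp_eq_toLp_iff]
    refine (diff_congr s p (Lp.coeFn_smul c u.1)).trans (Filter.EventuallyEq.of_eq ?_)
    ext z; simp [diff]; ring

instance fact_one_le [hp : Fact (2 ≤ p)] : Fact (1 ≤ ENNReal.ofReal p) :=
  ⟨by rw [ENNReal.one_le_ofReal]; linarith [hp.out]⟩

lemma toLp_injective [hN : Fact (1 < N)] [hp : Fact (2 ≤ p)] :
    Function.Injective (toLp : W0 Ω s p →ₗ[ℝ] _) := by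
  rw [injective_iff_map_eq_zero]
  intro u hu
  have h0 : diff u =ᵐ[gagliardoMeasure N s p] 0 := by
    have h1 : toLp u =ᵐ[gagliardoMeasure N s p] diff u := u.2.1.coeFn_toLp
    rw [hu] at h1
    exact h1.symm.trans (Lp.coeFn_zero _ _ _)
  have hm : Measurable fun z : E N × E N =>
      ENNReal.ofReal (‖z.1 - z.2‖ ^ (-((N : ℝ) + p * s))) := by fun_prop
  have h2 : ∀ᵐ z : E N × E N, diff u z = 0 := by
    filter_upwards [(ae_withDensity_iff hm).1 h0] with z hz
    by_cases hzz : z.1 = z.2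
    · simp [diff, hzz]
    · refine hz (ENNReal.ofReal_pos.2 (Real.rpow_pos_of_pos ?_ _)).ne'
      exact norm_pos_iff.2 (sub_ne_zero.2 hzz)
  have : Nonempty (Fin N) := ⟨⟨0, by have := hN.out; omega⟩⟩
  obtain ⟨x, hx⟩ := (Measure.ae_ae_of_ae_prod (μ := (volume : Measure (E N)))
    (ν := (volume : Measure (E N))) h2).exists
  have h3 : (fun _ : E N => u x) =ᵐ[volume] u := by
    filter_upwards [hx] with y hy
    simpa [diff, sub_eq_zero] using hy
  have h4 : MemLp (fun _ : E N => u x) (ENNReal.ofReal p) (volume : Measure (E N)) :=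
    (Lp.memLp u.1).ae_eq h3.symm
  have hp0 : ENNReal.ofReal p ≠ 0 := by
    rw [Ne, ENNReal.ofReal_eq_zero]; linarith [hp.out]
  have h5 : u x = 0 := by
    rcases (memLp_const_iff hp0 ENNReal.ofReal_ne_top).1 h4 with h | h
    · exact h
    · simp at h
  refine Subtype.ext ((Lp.eq_zero_iff_ae_eq_zero).2 ?_)
  rw [h5] at h3
  exact h3.symm

/-- The norm `‖u‖_{s,p} = [u]_{s,p}`, that is `(∬ |u(x) - u(y)|^p dμ)^{1/p}`. -/
instance [Fact (1 < N)] [Fact (2 ≤ p)] : NormedAddCommGroup (W0 Ω s p) :=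
  NormedAddCommGroup.induced _ _ (toLp : W0 Ω s p →ₗ[ℝ] _) toLp_injective

instance [Fact (1 < N)] [Fact (2 ≤ p)] : NormedSpace ℝ (W0 Ω s p) :=
  NormedSpace.induced ℝ _ _ (toLp : W0 Ω s p →ₗ[ℝ] _)

lemma norm_def [Fact (1 < N)] [Fact (2 ≤ p)] (u : W0 Ω s p) :
    ‖u‖ = (eLpNorm (diff u) (ENNReal.ofReal p) (gagliardoMeasure N s p)).toReal :=
  Lp.norm_toLp _ u.2.1

end W0

/-- `u ∈ L^p_loc(ℝ^N)`, `u ∈ W^{s,p}(U)` for some open `U ⊇ closure Ω`, and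
`|u|^{p-1} / (1 + |x|)^{N+ps}` is integrable on `ℝ^N`, that is, `u ∈ W̃^{s,p}(Ω)`. -/
structure MemWTilde {N : ℕ} (Ω : Set (E N)) (s p : ℝ) (u : E N → ℝ) : Prop where
  memLp_loc : ∀ K : Set (E N), IsCompact K → MemLp u (ENNReal.ofReal p) (volume.restrict K)
  exists_memW : ∃ U : Set (E N), IsOpen U ∧ closure Ω ⊆ U ∧ MemW s p U u
  integrable_tail :
    Integrable (fun x : E N => |u x| ^ (p - 1) / (1 + ‖x‖) ^ ((N : ℝ) + p * s)) volume

/-- The duality pairing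
`⟨(-Δ)_p^s u, v⟩ = ∬ |u(x) - u(y)|^{p-2} (u(x) - u(y)) (v(x) - v(y)) dμ`. -/
def pairing {N : ℕ} (s p : ℝ) (u v : E N → ℝ) : ℝ :=
  ∫ z, |u z.1 - u z.2| ^ (p - 2) * (u z.1 - u z.2) * (v z.1 - v z.2) ∂gagliardoMeasure N s p

/-- The hypothesis on the reaction: `f : Ω × ℝ → ℝ` is a Carathéodory function of subcritical
growth, with critical exponent `p_s^* = Np / (N - ps)`. -/
structure H0 {N : ℕ} (Ω : Set (E N)) (s p : ℝ) (f : E N → ℝ → ℝ) : Prop where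
  measurable : ∀ t : ℝ, AEMeasurable (fun x => f x t) (volume.restrict Ω)
  continuous : ∀ᵐ x ∂volume.restrict Ω, Continuous (f x)
  growth : ∃ c₀ q : ℝ, 0 < c₀ ∧ p < q ∧ q < N * p / (N - p * s) ∧
    ∀ᵐ x ∂volume.restrict Ω, ∀ t : ℝ, |f x t| ≤ c₀ * (1 + |t| ^ (q - 1))

/-- `u ∈ W̃^{s,p}(Ω)` is a supersolution of the Dirichlet problem. -/
structure IsSupersolution {N : ℕ} (Ω : Set (E N)) (s p : ℝ) (f : E N → ℝ → ℝ)
    (u : E N → ℝ) : Prop where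
  memWTilde : MemWTilde Ω s p u
  nonneg_compl : ∀ᵐ x ∂volume.restrict Ωᶜ, 0 ≤ u x
  le_pairing : ∀ v : W0 Ω s p, (∀ᵐ x, 0 ≤ v x) →
    ∫ x in Ω, f x (u x) * v x ≤ pairing s p u v

/-- `u ∈ W̃^{s,p}(Ω)` is a subsolution of the Dirichlet problem. -/
structure IsSubsolution {N : ℕ} (Ω : Set (E N)) (s p : ℝ) (f : E N → ℝ → ℝ)
    (u : E N → ℝ) : Prop where
  memWTilde : MemWTilde Ω s p u
  nonpos_compl : ∀ᵐ x ∂volume.restrict Ωᶜ, u x ≤ 0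
  pairing_le : ∀ v : W0 Ω s p, (∀ᵐ x, 0 ≤ v x) →
    pairing s p u v ≤ ∫ x in Ω, f x (u x) * v x

/-- `(lo, hi)` is a sub-supersolution pair. -/
structure IsSubSuperPair {N : ℕ} (Ω : Set (E N)) (s p : ℝ) (f : E N → ℝ → ℝ)
    (lo hi : E N → ℝ) : Prop where
  sub : IsSubsolution Ω s p f lo
  super : IsSupersolution Ω s p f hi
  le : ∀ᵐ x ∂volume.restrict Ω, lo x ≤ hi x

/-- `u ∈ W^{s,p}_0(Ω)` is a (weak) solution of `(-Δ)_p^s u = f(x,u)` in `Ω`, `u = 0` in `Ω^c`. -/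
def IsSolution {N : ℕ} {Ω : Set (E N)} {s p : ℝ} (f : E N → ℝ → ℝ) (u : W0 Ω s p) : Prop :=
  ∀ v : W0 Ω s p, pairing s p u v = ∫ x in Ω, f x (u x) * v x

/-- The set of the solutions `u` with `lo ≤ u ≤ hi` a.e. in `Ω`. -/
def solutionSet {N : ℕ} (Ω : Set (E N)) (s p : ℝ) (f : E N → ℝ → ℝ) (lo hi : E N → ℝ) :
    Set (W0 Ω s p) :=
  {u | IsSolution f u ∧ ∀ᵐ x ∂volume.restrict Ω, lo x ≤ u x ∧ u x ≤ hi x}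

end

end FracPLap

/-!
# Compactness of the solutions between a sub- and a supersolution

The solutions `u` with `lo ≤ u ≤ hi` are all dominated in `Ω` by `h = |lo| + |hi|`. Since `lo` and
`hi` lie in `W^{s,p}` of a neighbourhood of the closure of `Ω`, the subcritical Sobolev embedding
(`MemW.memLp`) gives `h ∈ L^q(Ω)`, where `q` is the growth exponent of `f`; hence all reaction terms
`f(x, u)` have a common majorant `G = c₀ (1 + h^{q-1})`, integrable against `h` and against every
test function (`IsSubSuperPair.exists_dominating`). Testing the equation with `u` itself bounds
`‖u‖_{s,p}`. A sequence of solutions then has a subsequence `v` converging almost everywhere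
(`exists_subseq_tendsto_ae`). For `p ≥ 2` the operator is strongly monotone
(`W0.norm_sub_rpow_le`), so subtracting the equations of `v k` and `v l` yields
`‖v k - v l‖ ^ p ≤ C ∫_Ω G |v k - v l|`, which tends to `0` by dominated convergence: the sequence
converges in norm, and its limit is again a solution between `lo` and `hi`.

The Sobolev embedding is obtained from superlevel sets. If `|u| > 2l` at `x` and `R` is a radius
whose ball has twice the measure of `{|u| > l}`, then `|u| ≤ l` on half of the ball `B(x, R)`, so
`x` contributes at least a multiple of `l^p R^{-ps}` to the Gagliardo energy. Hence a decay `l^{-r}`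
of the measure of `{|u| > l}` improves to `l^{-(p + r p s / N)}` (`SuperlevelDecay.improve`), and the
iteration of this map from `r = p` approaches the critical exponent. Almost everywhere convergence
follows from convergence in `L^1(Ω)`: the averages over balls of a fixed radius converge along a
weakly convergent subsequence in `L^2(Ω)`, while the energy controls the distance of a function from
its averages, uniformly as the radius tends to `0`.
-/

open Filter Topology

namespace FracPLap

variable {N : ℕ} {s p : ℝ}

/-! ### Subcritical Sobolev embedding -/

lemma measurable_gagliardo_density (N : ℕ) (s p : ℝ) : Measurable fun z : E N × E N =>
    ENNReal.ofReal (‖z.1 - z.2‖ ^ (-((N : ℝ) + p * s))) := by fun_prop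

lemma measurable_diff {u : E N → ℝ} (hu : Measurable u) : Measurable (diff u) :=
  (hu.comp measurable_fst).sub (hu.comp measurable_snd)

lemma setLIntegral_gagliardo {T : Set (E N)} (hT : MeasurableSet T) {F : E N × E N → ℝ≥0∞}
    (hF : Measurable F) :
    ∫⁻ z in T ×ˢ T, F z ∂gagliardoMeasure N s p =
      ∫⁻ x in T, ∫⁻ y in T, ENNReal.ofReal (‖x - y‖ ^ (-((N : ℝ) + p * s))) * F (x, y) := by
  have hm := measurable_gagliardo_density N s p
  rw [gagliardoMeasure, restrict_withDensity (hT.prod hT),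
    lintegral_withDensity_eq_lintegral_mul _ hm hF, Measure.volume_eq_prod,
    ← Measure.prod_restrict, lintegral_prod _ (hm.mul hF).aemeasurable]
  rfl

/-- If `|u| > 2l` at `x`, while `|u| ≤ l` on at least half of the ball of radius `R` around `x`,
then `x` contributes at least `l ^ p * R ^ (-p s)`, up to a constant, to the Gagliardo energy.
This is the source of the gain of integrability. -/
lemma measure_superlevel_mul_le (hp : 0 ≤ p) (hps : 0 ≤ (N : ℝ) + p * s) {u : E N → ℝ}
    (hu : Measurable u) {T T' : Set (E N)} (hT : MeasurableSet T) (hT' : MeasurableSet T')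
    {R l : ℝ} (hR : 0 < R) (hl : 0 < l) (hsub : ∀ x ∈ T, Metric.ball x R ⊆ T')
    (hsmall : 2 * volume {x | x ∈ T' ∧ l < |u x|} ≤ volume (Metric.ball (0 : E N) R)) :
    ENNReal.ofReal (R ^ (-((N : ℝ) + p * s)) * l ^ p) * (volume (Metric.ball (0 : E N) R) / 2) *
        volume {x | x ∈ T ∧ 2 * l < |u x|} ≤
      ∫⁻ z in T' ×ˢ T', ‖diff u z‖ₑ ^ p ∂gagliardoMeasure N s p := by
  have hmabs : Measurable fun x => |u x| := hu.abs
  have hA : MeasurableSet {x | x ∈ T ∧ 2 * l < |u x|} :=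
    hT.inter (measurableSet_lt measurable_const hmabs)
  have hB : MeasurableSet {x | x ∈ T' ∧ l < |u x|} :=
    hT'.inter (measurableSet_lt measurable_const hmabs)
  rw [setLIntegral_gagliardo hT' ((measurable_diff hu).enorm.pow_const p)]
  have hAT : {x | x ∈ T ∧ 2 * l < |u x|} ⊆ T' := fun x hx =>
    hsub x hx.1 (Metric.mem_ball_self hR)
  refine le_trans ?_ (lintegral_mono_set hAT)
  rw [← setLIntegral_const]
  refine setLIntegral_mono' hA fun x hx => ?_
  set S : Set (E N) := Metric.ball x R \ {x | x ∈ T' ∧ l < |u x|} with hS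
  have hST : S ⊆ T' := fun y hy => hsub x hx.1 hy.1
  have hSm : MeasurableSet S := Metric.isOpen_ball.measurableSet.diff hB
  refine le_trans ?_ (lintegral_mono_set hST)
  have hvol : volume (Metric.ball (0 : E N) R) / 2 ≤ volume S := by
    have hb : volume (Metric.ball x R) = volume (Metric.ball (0 : E N) R) :=
      Measure.addHaar_ball_center _ _ _
    have h1 : volume (Metric.ball x R) - volume {x | x ∈ T' ∧ l < |u x|} ≤ volume S :=
      le_measure_sdiff
    refine le_trans ?_ h1
    rw [hb]
    have h2 : volume {x | x ∈ T' ∧ l < |u x|} ≤ volume (Metric.ball (0 : E N) R) / 2 := by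
      rw [ENNReal.le_div_iff_mul_le (by simp) (by simp), mul_comm]
      exact hsmall
    calc volume (Metric.ball (0 : E N) R) / 2
        = volume (Metric.ball (0 : E N) R) - volume (Metric.ball (0 : E N) R) / 2 :=
          (ENNReal.sub_half measure_ball_lt_top.ne).symm
      _ ≤ _ := tsub_le_tsub_left h2 _
  refine le_trans (mul_le_mul_right hvol _) ?_
  rw [← setLIntegral_const]
  refine setLIntegral_mono' hSm fun y hy => ?_
  have huy : |u y| ≤ l := by
    by_contra h
    exact hy.2 ⟨hST hy, not_le.1 h⟩
  have hdu : l ≤ |u x - u y| := by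
    have := abs_sub_abs_le_abs_sub (u x) (u y)
    have := hx.2
    linarith
  have hxy : 0 < ‖x - y‖ := by
    refine norm_pos_iff.2 (sub_ne_zero.2 fun h => ?_)
    subst h
    have := hx.2
    linarith
  have hxyR : ‖x - y‖ ≤ R := by
    have := hy.1
    rw [Metric.mem_ball, dist_comm, dist_eq_norm] at this
    exact this.le
  rw [ENNReal.ofReal_mul (by positivity)]
  refine mul_le_mul' (ENNReal.ofReal_le_ofReal ?_) ?_
  · exact Real.rpow_le_rpow_of_nonpos hxy hxyR (by linarith)
  · rw [Real.enorm_eq_ofReal_abs, ENNReal.ofReal_rpow_of_nonneg (abs_nonneg _) hp]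
    exact ENNReal.ofReal_le_ofReal (Real.rpow_le_rpow hl.le hdu hp)

/-- Weak form of `u ∈ L^r` near `Ω`: for every radius `ρ < δ`, the superlevel sets `{|u| > l}` in
the `ρ`-neighbourhood of `Ω` have measure `O(l ^ (-r))` as `l → ∞`. The room between `ρ` and `δ` is used
up by the balls around the points of the neighbourhood. -/
def SuperlevelDecay (Ω : Set (E N)) (δ : ℝ) (u : E N → ℝ) (r : ℝ) : Prop :=
  ∀ ρ ∈ Ioo 0 δ, ∃ A l₀ : ℝ, 0 < A ∧ 0 < l₀ ∧ ∀ l, l₀ ≤ l →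
    volume {x | x ∈ Metric.thickening ρ Ω ∧ l < |u x|} ≤ ENNReal.ofReal (A * l ^ (-r))

lemma exists_volume_ball_eq (N : ℕ) [NeZero N] :
    ∃ ω : ℝ, 0 < ω ∧ ∀ R, 0 ≤ R → ∀ x : E N,
      volume (Metric.ball x R) = ENNReal.ofReal (ω * R ^ (N : ℝ)) := by
  have : Nonempty (Fin N) := ⟨0⟩
  refine ⟨(volume (Metric.ball (0 : E N) 1)).toReal,
    ENNReal.toReal_pos (Metric.measure_ball_pos _ _ one_pos).ne' measure_ball_lt_top.ne, ?_⟩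
  intro R hR x
  rw [Measure.addHaar_ball _ _ hR, ENNReal.ofReal_mul ENNReal.toReal_nonneg,
    ENNReal.ofReal_toReal measure_ball_lt_top.ne, mul_comm]
  simp [Real.rpow_natCast]

lemma SuperlevelDecay.improve [NeZero N] (hp : 0 < p) (hs : 0 < s) {Ω : Set (E N)} {δ r : ℝ}
    (hr : 0 < r) {u : E N → ℝ} (hu : Measurable u)
    (hE : ∫⁻ z in Metric.thickening δ Ω ×ˢ Metric.thickening δ Ω,
      ‖diff u z‖ₑ ^ p ∂gagliardoMeasure N s p ≠ ∞)
    (h : SuperlevelDecay Ω δ u r) : SuperlevelDecay Ω δ u (p + r * (p * s / N)) := by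
  intro ρ hρ
  obtain ⟨ω, hω, hball⟩ := exists_volume_ball_eq N
  obtain ⟨A, l₀, hA, hl₀, hdec⟩ := h ((ρ + δ) / 2) ⟨by linarith [hρ.1, hρ.2], by linarith [hρ.2]⟩
  have hN : (0 : ℝ) < N := Nat.cast_pos.2 (NeZero.pos N)
  have hmono : Metric.thickening ((ρ + δ) / 2) Ω ⊆ Metric.thickening δ Ω :=
    Metric.thickening_mono (by linarith [hρ.2]) _
  set K : ℝ := (∫⁻ z in Metric.thickening δ Ω ×ˢ Metric.thickening δ Ω,
      ‖diff u z‖ₑ ^ p ∂gagliardoMeasure N s p).toReal with hK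
  -- `B * l ^ (-r / N)` is the radius of the balls of measure `2 * A * l ^ (-r)`
  set B : ℝ := (2 * A / ω) ^ (1 / (N : ℝ)) with hB
  have hBpos : 0 < B := by positivity
  have hBN : ω * B ^ (N : ℝ) = 2 * A := by
    rw [hB, ← Real.rpow_mul (by positivity), one_div, inv_mul_cancel₀ hN.ne', Real.rpow_one]
    field_simp
  have hlim : Tendsto (fun l : ℝ => B * l ^ (-(r / N))) atTop (𝓝 (B * 0)) :=
    (tendsto_rpow_neg_atTop (by positivity)).const_mul B
  have hev : ∀ᶠ l : ℝ in atTop, B * l ^ (-(r / N)) < (δ - ρ) / 2 := by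
    refine hlim.eventually_lt_const ?_
    rw [mul_zero]; linarith [hρ.2]
  obtain ⟨l₁, hl₁⟩ := eventually_atTop.1 hev
  refine ⟨2 * (K + 1) * B ^ (p * s) / ω * 2 ^ (p + r * (p * s / N)), 2 * max l₀ l₁, ?_,
    by positivity, ?_⟩
  · have : 0 ≤ K := ENNReal.toReal_nonneg
    positivity
  intro l' hl'
  obtain ⟨l, rfl⟩ : ∃ l, l' = 2 * l := ⟨l' / 2, by ring⟩
  have hll₀ : l₀ ≤ l := by have := le_max_left l₀ l₁; linarith
  have hll₁ : l₁ ≤ l := by have := le_max_right l₀ l₁; linarith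
  have hl : 0 < l := hl₀.trans_le hll₀
  set R := B * l ^ (-(r / N)) with hR
  have hRpos : 0 < R := by positivity
  have hRN : ω * R ^ (N : ℝ) = 2 * (A * l ^ (-r)) := by
    rw [hR, Real.mul_rpow hBpos.le (by positivity), ← Real.rpow_mul hl.le, ← mul_assoc, hBN,
      neg_mul, div_mul_cancel₀ _ hN.ne']
    ring
  have key := measure_superlevel_mul_le (s := s) hp.le (by positivity) hu
    (T := Metric.thickening ρ Ω) (T' := Metric.thickening ((ρ + δ) / 2) Ω)
    Metric.isOpen_thickening.measurableSet Metric.isOpen_thickening.measurableSet hRpos hl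
    (fun x hx y hy => by
      rw [Metric.mem_thickening_iff] at hx ⊢
      obtain ⟨z, hz, hxz⟩ := hx
      refine ⟨z, hz, ?_⟩
      have h1 := dist_triangle y x z
      have h2 := Metric.mem_ball.1 hy
      have h3 := hl₁ l hll₁
      linarith)
    (by
      refine (mul_le_mul_right (hdec l hll₀) 2).trans ?_
      rw [hball _ hRpos.le, hRN, ENNReal.ofReal_mul two_pos.le]
      simp)
  have key2 := (key.trans (lintegral_mono_set (prod_mono hmono hmono))).trans_eq
    (ENNReal.ofReal_toReal hE).symm
  rw [← hK] at key2
  rw [hball _ hRpos.le, hRN, ENNReal.ofReal_mul two_pos.le, mul_comm (ENNReal.ofReal 2),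
    ENNReal.ofReal_ofNat, ENNReal.mul_div_cancel_right (by simp) (by simp),
    ← ENNReal.ofReal_mul (by positivity)] at key2
  have hc : 0 < R ^ (-((N : ℝ) + p * s)) * l ^ p * (A * l ^ (-r)) := by positivity
  rw [mul_comm, ← ENNReal.le_div_iff_mul_le (Or.inl (ENNReal.ofReal_pos.2 hc).ne') (by simp),
    ← ENNReal.ofReal_div_of_pos hc] at key2
  refine key2.trans (ENNReal.ofReal_le_ofReal ?_)
  rw [div_le_iff₀ hc]
  have e1 : R ^ (-((N : ℝ) + p * s)) = (R ^ (N : ℝ))⁻¹ * (R ^ (p * s))⁻¹ := by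
    rw [Real.rpow_neg hRpos.le, Real.rpow_add hRpos, mul_inv]
  have e2 : A * l ^ (-r) = ω * R ^ (N : ℝ) / 2 := by rw [hRN]; ring
  have e3 : R ^ (p * s) = B ^ (p * s) * (l ^ (r * (p * s / N)))⁻¹ := by
    rw [hR, Real.mul_rpow hBpos.le (by positivity), ← Real.rpow_mul hl.le, ← Real.rpow_neg hl.le]
    congr 2
    ring
  have e4 : (2 * l) ^ (-(p + r * (p * s / N))) =
      (2 ^ (p + r * (p * s / N)))⁻¹ * ((l ^ p)⁻¹ * (l ^ (r * (p * s / N)))⁻¹) := by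
    rw [Real.mul_rpow two_pos.le hl.le, Real.rpow_neg two_pos.le, Real.rpow_neg hl.le,
      Real.rpow_add hl, mul_inv]
  have hRN' : 0 < R ^ (N : ℝ) := by positivity
  rw [e1, e2, e3, e4]
  field_simp
  linarith

lemma SuperlevelDecay.of_memLp (hp : 0 < p) {Ω : Set (E N)} {δ : ℝ} {u : E N → ℝ}
    (hu : Measurable u)
    (h : MemLp u (ENNReal.ofReal p) (volume.restrict (Metric.thickening δ Ω))) :
    SuperlevelDecay Ω δ u p := by
  intro ρ hρ
  set C := eLpNorm u (ENNReal.ofReal p) (volume.restrict (Metric.thickening δ Ω)) with hC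
  refine ⟨C.toReal ^ p + 1, 1, by positivity, one_pos, fun l hl => ?_⟩
  have hl0 : 0 < l := one_pos.trans_le hl
  have h1 := mul_meas_ge_le_pow_eLpNorm' (volume.restrict (Metric.thickening δ Ω))
    (p := ENNReal.ofReal p) (by simpa using hp) ENNReal.ofReal_ne_top h.1 (ENNReal.ofReal l)
  rw [ENNReal.toReal_ofReal hp.le, ← hC, ← ENNReal.ofReal_toReal (a := C) h.2.ne,
    ENNReal.ofReal_rpow_of_nonneg ENNReal.toReal_nonneg hp.le,
    ENNReal.ofReal_rpow_of_nonneg hl0.le hp.le] at h1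
  have h2 : volume {x | x ∈ Metric.thickening ρ Ω ∧ l < |u x|} ≤
      (volume.restrict (Metric.thickening δ Ω)) {x | ENNReal.ofReal l ≤ ‖u x‖ₑ} := by
    rw [Measure.restrict_apply (measurableSet_le measurable_const hu.enorm)]
    refine measure_mono fun x hx => ⟨?_, Metric.thickening_mono hρ.2.le _ hx.1⟩
    rw [mem_ofPred_eq, Real.enorm_eq_ofReal_abs]
    exact ENNReal.ofReal_le_ofReal hx.2.le
  refine h2.trans ?_
  have hlp : 0 < l ^ p := by positivity
  rw [mul_comm, ← ENNReal.le_div_iff_mul_le (Or.inl (ENNReal.ofReal_pos.2 hlp).ne') (by simp),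
    ← ENNReal.ofReal_div_of_pos hlp] at h1
  refine h1.trans (ENNReal.ofReal_le_ofReal ?_)
  rw [Real.rpow_neg hl0.le, div_eq_mul_inv]
  gcongr
  linarith

/-- The exponents produced by iterating `r ↦ p + r * (p * s / N)` from `r = p` are the partial sums
of a geometric series with sum `p / (1 - p * s / N) = N * p / (N - p * s)`. -/
lemma SuperlevelDecay.of_lt_critical [NeZero N] (hp : 0 < p) (hs : 0 < s) (hN : p * s < N)
    {Ω : Set (E N)} {δ q : ℝ} {u : E N → ℝ} (hu : Measurable u)
    (hE : ∫⁻ z in Metric.thickening δ Ω ×ˢ Metric.thickening δ Ω,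
      ‖diff u z‖ₑ ^ p ∂gagliardoMeasure N s p ≠ ∞)
    (h : MemLp u (ENNReal.ofReal p) (volume.restrict (Metric.thickening δ Ω)))
    (hq : q < N * p / (N - p * s)) : ∃ r, q < r ∧ SuperlevelDecay Ω δ u r := by
  have hN0 : (0 : ℝ) < N := Nat.cast_pos.2 (NeZero.pos N)
  set t := p * s / N with ht
  have ht0 : 0 < t := by positivity
  have ht1 : t < 1 := (div_lt_one hN0).2 hN
  have hdec : ∀ k : ℕ, SuperlevelDecay Ω δ u (p * ∑ i ∈ Finset.range (k + 1), t ^ i) := by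
    intro k
    induction k with
    | zero => simpa using SuperlevelDecay.of_memLp hp hu h
    | succ k ih =>
      have hpos : 0 < p * ∑ i ∈ Finset.range (k + 1), t ^ i :=
        mul_pos hp (Finset.sum_pos (fun i _ => pow_pos ht0 i) (by simp))
      have h1 := ih.improve hp hs hpos hu hE
      rwa [← ht, show p + p * (∑ i ∈ Finset.range (k + 1), t ^ i) * t =
        p * ∑ i ∈ Finset.range (k + 1 + 1), t ^ i by
          rw [Finset.sum_range_succ' _ (k + 1)]
          simp only [pow_succ, pow_zero, ← Finset.sum_mul]; ring] at h1
  have hlim : Tendsto (fun k : ℕ => p * ∑ i ∈ Finset.range (k + 1), t ^ i) atTop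
      (𝓝 (p * (1 - t)⁻¹)) :=
    (((hasSum_geometric_of_lt_one ht0.le ht1).tendsto_sum_nat).comp
      (tendsto_add_atTop_nat 1)).const_mul p
  have hcrit : q < p * (1 - t)⁻¹ := by
    convert hq using 1
    rw [ht]
    have : (N : ℝ) - p * s ≠ 0 := by linarith
    have : 1 - p * s / (N : ℝ) ≠ 0 := by rw [← ht]; linarith
    field_simp
  obtain ⟨k, hk⟩ := (hlim.eventually_const_lt hcrit).exists
  exact ⟨_, hk, hdec k⟩

/-- A layer cake estimate: decay of the superlevel sets with exponent `r` gives integrability of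
every power `q < r` on sets of finite measure. -/
lemma SuperlevelDecay.memLp {Ω : Set (E N)} (hΩ : volume Ω ≠ ∞) {δ q r : ℝ} (hδ : 0 < δ)
    (hq : 1 ≤ q) (hqr : q < r) {u : E N → ℝ} (hu : Measurable u) (h : SuperlevelDecay Ω δ u r) :
    MemLp u (ENNReal.ofReal q) (volume.restrict Ω) := by
  obtain ⟨A, l₀, hA, hl₀, hdec⟩ := h (δ / 2) ⟨by linarith, by linarith⟩
  have hq0 : 0 < q := by linarith
  refine ⟨hu.aestronglyMeasurable, ?_⟩
  rw [eLpNorm_lt_top_iff_lintegral_rpow_enorm_lt_top (by simpa using hq0) ENNReal.ofReal_ne_top,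
    ENNReal.toReal_ofReal hq0.le]
  have h1 : ∀ x, ‖u x‖ₑ ^ q = ENNReal.ofReal (|u x| ^ q) := fun x => by
    rw [Real.enorm_eq_ofReal_abs, ENNReal.ofReal_rpow_of_nonneg (abs_nonneg _) hq0.le]
  simp only [h1]
  rw [lintegral_rpow_eq_lintegral_meas_lt_mul _ (Eventually.of_forall fun x => abs_nonneg (u x))
    hu.abs.aemeasurable hq0]
  refine ENNReal.mul_lt_top ENNReal.ofReal_lt_top ?_
  rw [← Ioc_union_Ioi_eq_Ioi hl₀.le]
  refine (lintegral_union_le _ _ _).trans_lt (ENNReal.add_lt_top.2 ⟨?_, ?_⟩)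
  · calc ∫⁻ l in Ioc 0 l₀, (volume.restrict Ω) {x | l < |u x|} * ENNReal.ofReal (l ^ (q - 1))
        ≤ ∫⁻ _ in Ioc 0 l₀, volume Ω * ENNReal.ofReal (l₀ ^ (q - 1)) := by
          refine setLIntegral_mono' measurableSet_Ioc fun l hl => mul_le_mul' ?_ ?_
          · exact (measure_mono (subset_univ _)).trans_eq (by simp)
          · exact ENNReal.ofReal_le_ofReal
              (Real.rpow_le_rpow hl.1.le hl.2 (by linarith))
      _ < ∞ := by
          rw [setLIntegral_const]
          exact ENNReal.mul_lt_top (ENNReal.mul_lt_top hΩ.lt_top ENNReal.ofReal_lt_top) (by simp)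
  · calc ∫⁻ l in Ioi l₀, (volume.restrict Ω) {x | l < |u x|} * ENNReal.ofReal (l ^ (q - 1))
        ≤ ∫⁻ l in Ioi l₀, ENNReal.ofReal (A * l ^ (q - 1 - r)) := by
          refine setLIntegral_mono' measurableSet_Ioi fun l hl => ?_
          have hl0 : 0 < l := hl₀.trans hl
          rw [sub_eq_add_neg (q - 1), add_comm, Real.rpow_add hl0, ← mul_assoc,
            ENNReal.ofReal_mul (by positivity)]
          refine mul_le_mul_left ((?_ : _ ≤ _).trans (hdec l (le_of_lt hl))) _
          rw [Measure.restrict_apply (measurableSet_lt measurable_const hu.abs)]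
          exact measure_mono fun x hx =>
            ⟨Metric.self_subset_thickening (by linarith) _ hx.2, hx.1⟩
      _ < ∞ := ((integrableOn_Ioi_rpow_of_lt (by linarith) hl₀).const_mul A).lintegral_lt_top

/-- Subcritical Sobolev embedding, from `W^{s,p}` of a neighbourhood of the closure of a bounded
set. -/
lemma MemW.memLp [NeZero N] (hp : 0 < p) (hs : 0 < s) (hN : p * s < N) {Ω U : Set (E N)}
    (hΩ : Bornology.IsBounded Ω) (hU : IsOpen U) (hΩU : closure Ω ⊆ U) {q : ℝ} (hq1 : 1 ≤ q)
    (hq : q < N * p / (N - p * s)) {u : E N → ℝ} (hu : MemW s p U u) :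
    MemLp u (ENNReal.ofReal q) (volume.restrict Ω) := by
  obtain ⟨δ, hδ, hδU⟩ := hΩ.isCompact_closure.exists_thickening_subset_open hU hΩU
  have hT : Metric.thickening δ Ω ⊆ U :=
    (Metric.thickening_subset_of_subset δ subset_closure).trans hδU
  have hΩU' : Ω ⊆ U := subset_closure.trans hΩU
  obtain ⟨w, hw, huw⟩ := hu.1.1.aemeasurable
  have hdw : diff u =ᵐ[(gagliardoMeasure N s p).restrict (U ×ˢ U)] diff w := by
    have h0 : ∀ᵐ x, x ∈ U → u x = w x := (ae_restrict_iff' hU.measurableSet).1 huw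
    rw [EventuallyEq, ae_restrict_iff' (hU.measurableSet.prod hU.measurableSet)]
    refine (withDensity_absolutelyContinuous _ _).ae_le ?_
    have h1 : ∀ᵐ z : E N × E N, z.1 ∈ U → u z.1 = w z.1 :=
      Measure.quasiMeasurePreserving_fst.ae h0
    have h2 : ∀ᵐ z : E N × E N, z.2 ∈ U → u z.2 = w z.2 :=
      Measure.quasiMeasurePreserving_snd.ae h0
    filter_upwards [h1, h2] with z hz1 hz2 hz
    simp [diff, hz1 hz.1, hz2 hz.2]
  have hE : ∫⁻ z in Metric.thickening δ Ω ×ˢ Metric.thickening δ Ω,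
      ‖diff w z‖ₑ ^ p ∂gagliardoMeasure N s p ≠ ∞ := by
    have h1 := (eLpNorm_lt_top_iff_lintegral_rpow_enorm_lt_top (by simpa using hp)
      ENNReal.ofReal_ne_top).1 (hu.2.ae_eq hdw).2
    rw [ENNReal.toReal_ofReal hp.le] at h1
    exact ((lintegral_mono_set (prod_mono hT hT)).trans_lt h1).ne
  obtain ⟨r, hqr, hr⟩ := SuperlevelDecay.of_lt_critical hp hs hN hw hE
    ((hu.1.ae_eq huw).mono_measure (Measure.restrict_mono hT le_rfl)) hq
  refine (hr.memLp hΩ.measure_lt_top.ne hδ hq1 hqr hw).ae_eq ?_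
  exact EventuallyEq.symm (ae_restrict_of_ae_restrict_of_subset hΩU' huw)

/-! ### Inequalities for the nonlinearity `|t|^{p-2} t` -/

lemma abs_rpow_sub_two_mul_self {p a : ℝ} (hp : 2 ≤ p) (ha : 0 ≤ a) :
    |a| ^ (p - 2) * a = a ^ (p - 1) := by
  rw [abs_of_nonneg ha]
  rcases ha.eq_or_lt with rfl | ha
  · rw [mul_zero, Real.zero_rpow (by linarith)]
  · nth_rewrite 2 [← Real.rpow_one a]
    rw [← Real.rpow_add ha]
    congr 1; ring

lemma abs_rpow_sub_two_mul_neg {p a : ℝ} :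
    |-a| ^ (p - 2) * (-a) = -(|a| ^ (p - 2) * a) := by
  rw [abs_neg]; ring

/-- Strong monotonicity of `t ↦ |t|^{p-2} t` for `p ≥ 2`. -/
lemma mul_abs_sub_rpow_le {p : ℝ} (hp : 2 ≤ p) (a b : ℝ) :
    (2 ^ (p - 1))⁻¹ * |a - b| ^ p ≤
      (|a| ^ (p - 2) * a - |b| ^ (p - 2) * b) * (a - b) := by
  have hC : (1 : ℝ) ≤ 2 ^ (p - 1) := Real.one_le_rpow (by norm_num) (by linarith)
  have hC0 : (0 : ℝ) < 2 ^ (p - 1) := by positivity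
  -- both arguments nonnegative: superadditivity of `t ↦ t ^ (p - 1)`
  have same : ∀ a b : ℝ, 0 ≤ b → b ≤ a → (2 ^ (p - 1))⁻¹ * (a - b) ^ (p - 1) ≤
      |a| ^ (p - 2) * a - |b| ^ (p - 2) * b := by
    intro a b hb hab
    rw [abs_rpow_sub_two_mul_self hp hb, abs_rpow_sub_two_mul_self hp (hb.trans hab)]
    have h1 := NNReal.add_rpow_le_rpow_add (p := p - 1) (a - b).toNNReal b.toNNReal (by linarith)
    rw [← Real.toNNReal_add (by linarith) hb, sub_add_cancel, ← NNReal.coe_le_coe] at h1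
    push_cast at h1
    rw [Real.coe_toNNReal _ (by linarith), Real.coe_toNNReal _ hb,
      Real.coe_toNNReal _ (hb.trans hab)] at h1
    have h2 : (2 ^ (p - 1))⁻¹ * (a - b) ^ (p - 1) ≤ (a - b) ^ (p - 1) :=
      mul_le_of_le_one_left (Real.rpow_nonneg (by linarith) _) (inv_le_one_of_one_le₀ hC)
    linarith
  have main : ∀ a b : ℝ, b ≤ a → (2 ^ (p - 1))⁻¹ * (a - b) ^ (p - 1) ≤
      |a| ^ (p - 2) * a - |b| ^ (p - 2) * b := by
    intro a b hab
    rcases le_total 0 b with hb | hb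
    · exact same a b hb hab
    rcases le_total a 0 with ha | ha
    · have h := same (-b) (-a) (by linarith) (by linarith)
      rw [abs_rpow_sub_two_mul_neg, abs_rpow_sub_two_mul_neg] at h
      rw [show a - b = -b - -a by ring]
      linarith
    · obtain ⟨c, rfl⟩ : ∃ c, b = -c := ⟨-b, by ring⟩
      have hc : 0 ≤ c := by linarith
      rw [abs_rpow_sub_two_mul_neg, abs_rpow_sub_two_mul_self hp ha,
        abs_rpow_sub_two_mul_self hp hc, inv_mul_le_iff₀ hC0, sub_neg_eq_add, sub_neg_eq_add]
      have hac : 0 ≤ a ^ (p - 1) := Real.rpow_nonneg ha _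
      have hcc : 0 ≤ c ^ (p - 1) := Real.rpow_nonneg hc _
      rcases le_total a c with h | h
      · calc (a + c) ^ (p - 1) ≤ (2 * c) ^ (p - 1) :=
              Real.rpow_le_rpow (by linarith) (by linarith) (by linarith)
          _ = 2 ^ (p - 1) * c ^ (p - 1) := Real.mul_rpow two_pos.le hc
          _ ≤ _ := by gcongr; linarith
      · calc (a + c) ^ (p - 1) ≤ (2 * a) ^ (p - 1) :=
              Real.rpow_le_rpow (by linarith) (by linarith) (by linarith)
          _ = 2 ^ (p - 1) * a ^ (p - 1) := Real.mul_rpow two_pos.le ha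
          _ ≤ _ := by gcongr; linarith
  have fin : ∀ a b : ℝ, b ≤ a → (2 ^ (p - 1))⁻¹ * |a - b| ^ p ≤
      (|a| ^ (p - 2) * a - |b| ^ (p - 2) * b) * (a - b) := by
    intro a b hab
    have h0 : 0 ≤ a - b := by linarith
    have h1 : |a - b| ^ p = (a - b) ^ (p - 1) * (a - b) := by
      rw [abs_of_nonneg h0, ← Real.rpow_add_one' h0 (by linarith)]
      congr 1; ring
    rw [h1, ← mul_assoc]
    exact mul_le_mul_of_nonneg_right (main a b hab) h0
  rcases le_total b a with h | h
  · exact fin a b h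
  · have := fin b a h
    rw [abs_sub_comm]
    linarith

/-- Lipschitz bound on `[-m, m]` for `t ↦ |t|^{p-2} t`. -/
lemma abs_sub_le_mul_max_rpow {p : ℝ} (hp : 2 ≤ p) {a b m : ℝ} (ha : |a| ≤ m) (hb : |b| ≤ m) :
    |(|a| ^ (p - 2) * a - |b| ^ (p - 2) * b)| ≤ (p - 1) * |a - b| * m ^ (p - 2) := by
  have hm : 0 ≤ m := (abs_nonneg a).trans ha
  have same : ∀ a b : ℝ, 0 ≤ b → b ≤ a → a ≤ m →
      |(|a| ^ (p - 2) * a - |b| ^ (p - 2) * b)| ≤ (p - 1) * |a - b| * m ^ (p - 2) := by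
    intro a b hb hab ham
    rcases (hb.trans hab).eq_or_lt with h0 | ha0
    · have : b = 0 := by linarith
      subst this; subst h0; simp
    rw [abs_rpow_sub_two_mul_self hp hb, abs_rpow_sub_two_mul_self hp ha0.le]
    have h1 : b ^ (p - 1) ≤ a ^ (p - 1) := Real.rpow_le_rpow hb hab (by linarith)
    rw [abs_of_nonneg (sub_nonneg.2 h1), abs_of_nonneg (sub_nonneg.2 hab)]
    -- Bernoulli's inequality for the ratio `b / a`
    have h2 := one_add_mul_self_le_rpow_one_add (s := b / a - 1) (p := p - 1)
      (by have : 0 ≤ b / a := by positivity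
          linarith) (by linarith)
    rw [add_sub_cancel, Real.div_rpow hb ha0.le, le_div_iff₀ (by positivity)] at h2
    have h3 : a ^ (p - 1) = a ^ (p - 2) * a := by
      rw [← Real.rpow_add_one ha0.ne']; congr 1; ring
    have h4 : a ^ (p - 1) - b ^ (p - 1) ≤ (p - 1) * (a - b) * a ^ (p - 2) := by
      have : (1 + (p - 1) * (b / a - 1)) * a ^ (p - 1) =
          a ^ (p - 1) - (p - 1) * (a - b) * a ^ (p - 2) := by
        rw [h3]; field_simp; ring
      linarith
    refine h4.trans ?_
    have : a ^ (p - 2) ≤ m ^ (p - 2) := Real.rpow_le_rpow ha0.le ham (by linarith)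
    exact mul_le_mul_of_nonneg_left this (mul_nonneg (by linarith) (by linarith))
  have main : ∀ a b : ℝ, |a| ≤ m → |b| ≤ m → b ≤ a →
      |(|a| ^ (p - 2) * a - |b| ^ (p - 2) * b)| ≤ (p - 1) * |a - b| * m ^ (p - 2) := by
    intro a b ha hb hab
    rcases le_total 0 b with h | h
    · exact same a b h hab ((le_abs_self a).trans ha)
    rcases le_total a 0 with h' | h'
    · have h1 := same (-b) (-a) (by linarith) (by linarith) ((neg_le_abs b).trans hb)
      rw [abs_rpow_sub_two_mul_neg, abs_rpow_sub_two_mul_neg] at h1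
      rw [show a - b = -b - -a by ring]
      convert h1 using 2
      ring
    · have ea : |a| ^ (p - 2) ≤ m ^ (p - 2) :=
        Real.rpow_le_rpow (abs_nonneg _) ha (by linarith)
      have eb : |b| ^ (p - 2) ≤ m ^ (p - 2) :=
        Real.rpow_le_rpow (abs_nonneg _) hb (by linarith)
      have ea0 : 0 ≤ |a| ^ (p - 2) := by positivity
      have eb0 : 0 ≤ |b| ^ (p - 2) := by positivity
      have em : 0 ≤ m ^ (p - 2) := by positivity
      have h5 : 0 ≤ |a| ^ (p - 2) * a := mul_nonneg ea0 h'
      have h6 : 0 ≤ |b| ^ (p - 2) * (-b) := mul_nonneg eb0 (by linarith)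
      rw [abs_of_nonneg (by linarith), abs_of_nonneg (by linarith : 0 ≤ a - b)]
      have h7 := mul_le_mul_of_nonneg_right ea h'
      have h8 := mul_le_mul_of_nonneg_right eb (by linarith : 0 ≤ -b)
      have h9 : 0 ≤ (p - 2) * ((a - b) * m ^ (p - 2)) :=
        mul_nonneg (by linarith) (mul_nonneg (by linarith) em)
      linarith
  rcases le_total b a with h | h
  · exact main a b ha hb h
  · have := main b a hb ha h
    rwa [abs_sub_comm, abs_sub_comm b a] at this

/-- Young-type estimate: the increment of `|t|^{p-2} t`, tested against `b`, is small up to a large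
multiple of `|c - a| ^ p`. -/
lemma abs_sub_mul_le {p : ℝ} (hp : 2 ≤ p) {η : ℝ} (hη : 0 < η) (hη1 : η ≤ 1) (a b c : ℝ) :
    |(|c| ^ (p - 2) * c - |a| ^ (p - 2) * a)| * |b| ≤
      (p - 1) * 2 ^ (p - 2) * η * (η⁻¹ ^ p * |c - a| ^ p + |a| ^ p + |b| ^ p) := by
  set X := max (η⁻¹ * |c - a|) (max |a| |b|) with hX
  have hX0 : 0 ≤ X := le_max_of_le_right (le_max_of_le_left (abs_nonneg a))
  have h1 : η⁻¹ * |c - a| ≤ X := le_max_left _ _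
  have h2 : |a| ≤ X := (le_max_left _ _).trans (le_max_right _ _)
  have h3 : |b| ≤ X := (le_max_right _ _).trans (le_max_right _ _)
  have h4 : |c - a| ≤ η * X := by rwa [inv_mul_le_iff₀ hη] at h1
  have h5 : |c| ≤ 2 * X := by
    have : |c| ≤ |c - a| + |a| := by simpa using abs_add_le (c - a) a
    nlinarith
  have h6 := abs_sub_le_mul_max_rpow hp h5 (h2.trans (by linarith : X ≤ 2 * X))
  have hXp : X ^ p ≤ η⁻¹ ^ p * |c - a| ^ p + |a| ^ p + |b| ^ p := by
    rw [← Real.mul_rpow (by positivity) (abs_nonneg _)]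
    have e1 : 0 ≤ (η⁻¹ * |c - a|) ^ p := by positivity
    have e2 : 0 ≤ |a| ^ p := by positivity
    have e3 : 0 ≤ |b| ^ p := by positivity
    rcases max_choice (η⁻¹ * |c - a|) (max |a| |b|) with h | h
    · rw [hX, h]; linarith
    · rcases max_choice |a| |b| with h' | h' <;> rw [hX, h, h'] <;> linarith
  have hXX : X ^ p = X ^ (p - 2) * X * X := by
    rw [← Real.rpow_add_one' hX0 (by linarith), ← Real.rpow_add_one' hX0 (by linarith)]
    congr 1; ring
  calc |(|c| ^ (p - 2) * c - |a| ^ (p - 2) * a)| * |b|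
      ≤ ((p - 1) * (η * X) * (2 * X) ^ (p - 2)) * X := by
        refine mul_le_mul (h6.trans ?_) h3 (abs_nonneg _) ?_
        · exact mul_le_mul_of_nonneg_right (mul_le_mul_of_nonneg_left h4 (by linarith))
            (by positivity)
        · have : 0 ≤ p - 1 := by linarith
          positivity
    _ = (p - 1) * 2 ^ (p - 2) * η * X ^ p := by
        rw [Real.mul_rpow two_pos.le hX0, hXX]; ring
    _ ≤ _ := by
        refine mul_le_mul_of_nonneg_left hXp ?_
        have : 0 ≤ p - 1 := by linarith
        positivity

lemma abs_mul_mul_le_rpow_add {p : ℝ} (hp : 2 ≤ p) (a b : ℝ) :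
    |(|a| ^ (p - 2) * a * b)| ≤ |a| ^ p + |b| ^ p := by
  rw [abs_mul, abs_mul, abs_of_nonneg (by positivity : 0 ≤ |a| ^ (p - 2))]
  have e : ∀ m : ℝ, 0 ≤ m → m ^ (p - 2) * m * m = m ^ p := fun m hm => by
    rw [← Real.rpow_add_one' hm (by linarith), ← Real.rpow_add_one' hm (by linarith)]
    congr 1; ring
  rcases le_total |a| |b| with h | h
  · have : |a| ^ (p - 2) * |a| * |b| ≤ |b| ^ (p - 2) * |b| * |b| := by gcongr
    rw [e _ (abs_nonneg _)] at this
    have : 0 ≤ |a| ^ p := by positivity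
    linarith
  · have : |a| ^ (p - 2) * |a| * |b| ≤ |a| ^ (p - 2) * |a| * |a| := by gcongr
    rw [e _ (abs_nonneg _)] at this
    have : 0 ≤ |b| ^ p := by positivity
    linarith

section Integrals

variable {α : Type*} [MeasurableSpace α] {μ : Measure α} {p : ℝ}

lemma integrable_abs_rpow (hp : 2 ≤ p) {w : α → ℝ} (hw : MemLp w (ENNReal.ofReal p) μ) :
    Integrable (fun z => |w z| ^ p) μ := by
  have := hw.integrable_norm_rpow (by simp; linarith) ENNReal.ofReal_ne_top
  rwa [ENNReal.toReal_ofReal (by linarith)] at this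

lemma integral_abs_rpow (hp : 2 ≤ p) {w : α → ℝ} (hw : MemLp w (ENNReal.ofReal p) μ) :
    ∫ z, |w z| ^ p ∂μ = (eLpNorm w (ENNReal.ofReal p) μ).toReal ^ p := by
  have hp0 : 0 < p := by linarith
  rw [hw.eLpNorm_eq_integral_rpow_norm (by simpa using hp0) ENNReal.ofReal_ne_top,
    ENNReal.toReal_ofReal hp0.le, ENNReal.toReal_ofReal (by positivity),
    ← Real.rpow_mul (by positivity), inv_mul_cancel₀ hp0.ne', Real.rpow_one]
  rfl

lemma aestronglyMeasurable_abs_rpow_mul {w v : α → ℝ} (hw : AEStronglyMeasurable w μ)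
    (hv : AEStronglyMeasurable v μ) :
    AEStronglyMeasurable (fun z => |w z| ^ (p - 2) * w z * v z) μ :=
  (((hw.aemeasurable.abs.pow_const _).mul hw.aemeasurable).mul hv.aemeasurable).aestronglyMeasurable

lemma integrable_abs_rpow_mul (hp : 2 ≤ p) {w v : α → ℝ} (hw : MemLp w (ENNReal.ofReal p) μ)
    (hv : MemLp v (ENNReal.ofReal p) μ) :
    Integrable (fun z => |w z| ^ (p - 2) * w z * v z) μ :=
  ((integrable_abs_rpow hp hw).add (integrable_abs_rpow hp hv)).mono'
    (aestronglyMeasurable_abs_rpow_mul hw.1 hv.1)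
    (Eventually.of_forall fun z => abs_mul_mul_le_rpow_add hp (w z) (v z))

/-- The functional `w ↦ ∫ |w|^{p-2} w v` is sequentially continuous on `L^p`, for `v ∈ L^p`. -/
lemma tendsto_integral_abs_rpow_mul (hp : 2 ≤ p) {w : ℕ → α → ℝ} {w' v : α → ℝ}
    (hw : ∀ n, MemLp (w n) (ENNReal.ofReal p) μ) (hw' : MemLp w' (ENNReal.ofReal p) μ)
    (hv : MemLp v (ENNReal.ofReal p) μ)
    (h : Tendsto (fun n => eLpNorm (w n - w') (ENNReal.ofReal p) μ) atTop (𝓝 0)) :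
    Tendsto (fun n => ∫ z, |w n z| ^ (p - 2) * w n z * v z ∂μ) atTop
      (𝓝 (∫ z, |w' z| ^ (p - 2) * w' z * v z ∂μ)) := by
  have hp0 : 0 < p := by linarith
  have h0 : Tendsto (fun n => ∫ z, |w n z - w' z| ^ p ∂μ) atTop (𝓝 0) := by
    have e : ∀ n, ∫ z, |w n z - w' z| ^ p ∂μ =
        (eLpNorm (w n - w') (ENNReal.ofReal p) μ).toReal ^ p := fun n =>
      integral_abs_rpow hp ((hw n).sub hw')
    simp only [e]
    have h1 := ((ENNReal.tendsto_toReal ENNReal.zero_ne_top).comp h).rpow_const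
      (p := p) (Or.inr hp0.le)
    simpa [Real.zero_rpow hp0.ne'] using h1
  set V := ∫ z, |w' z| ^ p ∂μ + ∫ z, |v z| ^ p ∂μ with hV
  have hV0 : 0 ≤ V := by positivity
  set K := (p - 1) * 2 ^ (p - 2) with hK
  have hK0 : 0 ≤ K := mul_nonneg (by linarith) (by positivity)
  have bound : ∀ η, 0 < η → η ≤ 1 → ∀ n,
      |∫ z, |w n z| ^ (p - 2) * w n z * v z ∂μ - ∫ z, |w' z| ^ (p - 2) * w' z * v z ∂μ| ≤
        K * η * (η⁻¹ ^ p * ∫ z, |w n z - w' z| ^ p ∂μ + V) := by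
    intro η hη hη1 n
    have i1 := integrable_abs_rpow hp ((hw n).sub hw')
    have i2 := integrable_abs_rpow hp hw'
    have i3 := integrable_abs_rpow hp hv
    simp only [Pi.sub_apply] at i1
    rw [← integral_sub (integrable_abs_rpow_mul hp (hw n) hv) (integrable_abs_rpow_mul hp hw' hv)]
    have i4 : Integrable (fun z => K * η * (η⁻¹ ^ p * |w n z - w' z| ^ p + |w' z| ^ p + |v z| ^ p))
        μ := (((i1.const_mul _).add i2).add i3).const_mul _
    have e4 : ∫ z, K * η * (η⁻¹ ^ p * |w n z - w' z| ^ p + |w' z| ^ p + |v z| ^ p) ∂μ =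
        K * η * (η⁻¹ ^ p * ∫ z, |w n z - w' z| ^ p ∂μ + V) := by
      have i5 : Integrable (fun z => η⁻¹ ^ p * |w n z - w' z| ^ p + |w' z| ^ p) μ :=
        (i1.const_mul _).add i2
      rw [integral_const_mul, integral_add i5 i3, integral_add (i1.const_mul _) i2,
        integral_const_mul, hV, add_assoc]
    rw [← e4, ← Real.norm_eq_abs]
    refine norm_integral_le_of_norm_le i4 (Eventually.of_forall fun z => ?_)
    have := abs_sub_mul_le hp hη hη1 (w' z) (v z) (w n z)
    rw [← abs_mul, sub_mul] at this
    exact this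
  rw [Metric.tendsto_atTop]
  intro ε hε
  set η := min 1 (ε / (2 * (K * V + 1))) with hη
  have hη0 : 0 < η := by positivity
  have hη1 : η ≤ 1 := min_le_left _ _
  have hηV : K * η * V < ε / 2 + ε / 4 := by
    have h2 : η ≤ ε / (2 * (K * V + 1)) := min_le_right _ _
    have h3 : 0 ≤ K * V := by positivity
    rw [le_div_iff₀ (by positivity)] at h2
    nlinarith
  have h5 : Tendsto (fun n => K * η * (η⁻¹ ^ p * ∫ z, |w n z - w' z| ^ p ∂μ + V)) atTop
      (𝓝 (K * η * (η⁻¹ ^ p * 0 + V))) :=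
    ((h0.const_mul _).add_const V).const_mul _
  rw [mul_zero, zero_add] at h5
  obtain ⟨n₀, hn₀⟩ := eventually_atTop.1 (h5.eventually_lt_const (hηV.trans (by linarith : _ < ε)))
  exact ⟨n₀, fun n hn => (bound η hη0 hη1 n).trans_lt (hn₀ n hn)⟩

/-- Composition of a Carathéodory function with a measurable function is measurable. -/
lemma aemeasurable_caratheodory {f : α → ℝ → ℝ} (hf : ∀ t, AEMeasurable (fun x => f x t) μ)
    (hc : ∀ᵐ x ∂μ, Continuous (f x)) {u : α → ℝ} (hu : AEMeasurable u μ) :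
    AEMeasurable (fun x => f x (u x)) μ := by
  obtain ⟨w, hw, huw⟩ := hu
  have hsimple : ∀ φ : SimpleFunc α ℝ, AEMeasurable (fun x => f x (φ x)) μ := by
    intro φ
    have e : (fun x => f x (φ x)) =
        fun x => ∑ t ∈ φ.range, (φ ⁻¹' {t}).indicator (fun x => f x t) x := by
      ext x
      rw [Finset.sum_eq_single (φ x)]
      · simp
      · intro t _ ht
        exact indicator_of_notMem (fun h => ht (by simpa using h.symm)) _
      · intro h
        exact absurd (SimpleFunc.mem_range_self φ x) h
    rw [e]
    exact Finset.aemeasurable_fun_sum _ fun t _ => (hf t).indicator (φ.measurableSet_fiber t)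
  have hlim : AEMeasurable (fun x => f x (w x)) μ := by
    refine aemeasurable_of_tendsto_metrizable_ae atTop
      (fun n => hsimple (hw.stronglyMeasurable.approx n)) ?_
    filter_upwards [hc] with x hx
    exact (hx.tendsto _).comp (hw.stronglyMeasurable.tendsto_approx x)
  refine hlim.congr ?_
  filter_upwards [huw] with x hx
  rw [hx]

end Integrals

/-! ### Compactness in `L^1` -/

section WeakCompactness

variable {α : Type*} [MeasurableSpace α] {ν : Measure α}

/-- Weak sequential compactness of a sequence dominated in `L^2`, in the form of convergence of the
integrals over each measurable set. -/
lemma exists_subseq_tendsto_setIntegral [IsFiniteMeasure ν] [IsSeparable ν] {u : ℕ → α → ℝ}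
    {h : α → ℝ} (hu : ∀ n, AEStronglyMeasurable (u n) ν) (hh : MemLp h 2 ν)
    (huh : ∀ n, ∀ᵐ x ∂ν, |u n x| ≤ h x) :
    ∃ ns : ℕ → ℕ, StrictMono ns ∧ ∀ S, MeasurableSet S →
      ∃ ℓ, Tendsto (fun k => ∫ x in S, u (ns k) x ∂ν) atTop (𝓝 ℓ) := by
  have hu2 : ∀ n, MemLp (u n) 2 ν := fun n =>
    hh.mono' (hu n) (by filter_upwards [huh n] with x hx using hx)
  have hle : ∀ n, ‖(hu2 n).toLp‖ ≤ ‖hh.toLp‖ := fun n => by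
    refine Lp.norm_le_norm_of_ae_le ?_
    filter_upwards [huh n, (hu2 n).coeFn_toLp, hh.coeFn_toLp] with x h1 h2 h3
    rw [h2, h3]
    exact h1.trans (le_abs_self _)
  have : Fact ((2 : ℝ≥0∞) ≠ ∞) := ⟨by simp⟩
  obtain ⟨φ, -, ns, hns, hlim⟩ := WeakDual.isSeqCompact_closedBall ℝ (Lp ℝ 2 ν) 0 ‖hh.toLp‖
    (x := fun n => StrongDual.toWeakDual (innerSL ℝ (hu2 n).toLp)) (fun n => by
      rw [mem_preimage, Metric.mem_closedBall, dist_zero_right]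
      exact (innerSL_apply_norm (𝕜 := ℝ) (hu2 n).toLp).trans_le (hle n))
  refine ⟨ns, hns, fun S hS => ?_⟩
  refine ⟨φ (indicatorConstLp 2 hS (measure_ne_top ν S) 1), ?_⟩
  have h1 := ((WeakDual.eval_continuous (𝕜 := ℝ)
    (indicatorConstLp 2 hS (measure_ne_top ν S) (1 : ℝ))).tendsto φ).comp hlim
  refine h1.congr fun k => ?_
  change inner ℝ (hu2 (ns k)).toLp (indicatorConstLp 2 hS (measure_ne_top ν S) (1 : ℝ)) = _
  rw [real_inner_comm, L2.inner_indicatorConstLp_one]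
  exact setIntegral_congr_ae₀ hS.nullMeasurableSet
    (by filter_upwards [(hu2 (ns k)).coeFn_toLp] with x hx _ using hx)

end WeakCompactness

lemma abs_le_add_kernel_mul_rpow (hp : 1 ≤ p) {κ τ ε d r : ℝ} (hκ : 0 ≤ κ) (hτ : 0 < τ)
    (hr : 0 < r) (hrε : r ≤ ε) :
    |d| ≤ τ + τ ^ (1 - p) * ε ^ κ * (r ^ (-κ) * |d| ^ p) := by
  have hε : 0 < ε := hr.trans_le hrε
  have h0 : 0 ≤ τ ^ (1 - p) * ε ^ κ * (r ^ (-κ) * |d| ^ p) := by positivity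
  rcases le_or_gt |d| τ with h | h
  · linarith
  · have hd : 0 < |d| := hτ.trans h
    have h1 : 1 ≤ ε ^ κ * r ^ (-κ) := by
      rw [Real.rpow_neg hr.le, ← div_eq_mul_inv, one_le_div (by positivity)]
      exact Real.rpow_le_rpow hr.le hrε hκ
    have h2 : |d| ^ (1 - p) ≤ τ ^ (1 - p) := Real.rpow_le_rpow_of_nonpos hτ h.le (by linarith)
    calc |d| = |d| ^ (1 - p) * |d| ^ p * 1 := by
          rw [← Real.rpow_add hd, sub_add_cancel, Real.rpow_one, mul_one]
      _ ≤ τ ^ (1 - p) * |d| ^ p * (ε ^ κ * r ^ (-κ)) := by gcongr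
      _ ≤ τ + τ ^ (1 - p) * ε ^ κ * (r ^ (-κ) * |d| ^ p) := by linarith

/-- The distance in `L^1` from a function to its averages over balls of radius `ε` is controlled by
its Gagliardo energy. -/
lemma volume_ball_mul_lintegral_le (hp : 1 ≤ p) (hps : 0 ≤ (N : ℝ) + p * s) {w : E N → ℝ}
    (hw : Measurable w) (hwi : LocallyIntegrable w) {Ω : Set (E N)} {ε τ : ℝ}
    (hε : 0 < ε) (hτ : 0 < τ) :
    volume (Metric.ball (0 : E N) ε) * ∫⁻ x in Ω, ‖w x‖ₑ ≤
      (∫⁻ x in Ω, ‖∫ y in Metric.ball x ε, w y‖ₑ) +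
        (ENNReal.ofReal τ * volume (Metric.ball (0 : E N) ε) * volume Ω +
        ENNReal.ofReal (τ ^ (1 - p) * ε ^ ((N : ℝ) + p * s)) *
          ∫⁻ z, ‖diff w z‖ₑ ^ p ∂gagliardoMeasure N s p) := by
  set κ := (N : ℝ) + p * s with hκ
  set C := ENNReal.ofReal (τ ^ (1 - p) * ε ^ κ) with hC
  set k : E N → E N → ℝ≥0∞ := fun x y =>
    ENNReal.ofReal (‖x - y‖ ^ (-κ)) * ‖w x - w y‖ₑ ^ p with hk
  have hkm : Measurable (Function.uncurry k) :=
    (measurable_gagliardo_density N s p).mul ((measurable_diff hw).enorm.pow_const p)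
  have hpt : ∀ x, volume (Metric.ball (0 : E N) ε) * ‖w x‖ₑ ≤
      ‖∫ y in Metric.ball x ε, w y‖ₑ +
        (ENNReal.ofReal τ * volume (Metric.ball (0 : E N) ε) + C * ∫⁻ y, k x y) := by
    intro x
    have hvol : volume (Metric.ball x ε) = volume (Metric.ball (0 : E N) ε) :=
      Measure.addHaar_ball_center _ _ _
    have hwx : IntegrableOn w (Metric.ball x ε) :=
      (hwi.integrableOn_isCompact (isCompact_closedBall x ε)).mono_set
        Metric.ball_subset_closedBall
    have hconst : IntegrableOn (fun _ : E N => w x) (Metric.ball x ε) :=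
      integrableOn_const measure_ball_lt_top.ne
    have e1 : (volume.real (Metric.ball x ε)) * w x =
        (∫ y in Metric.ball x ε, (w x - w y)) + ∫ y in Metric.ball x ε, w y := by
      rw [integral_sub hconst hwx, sub_add_cancel, setIntegral_const, smul_eq_mul]
    have e2 : volume (Metric.ball (0 : E N) ε) * ‖w x‖ₑ =
        ‖(volume.real (Metric.ball x ε)) * w x‖ₑ := by
      rw [enorm_mul, Real.enorm_of_nonneg measureReal_nonneg, ofReal_measureReal
        measure_ball_lt_top.ne, hvol]
    have e3 : ∫⁻ y in Metric.ball x ε, ‖w x - w y‖ₑ ≤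
        ENNReal.ofReal τ * volume (Metric.ball (0 : E N) ε) + C * ∫⁻ y, k x y := by
      have hkx : Measurable (k x) := hkm.of_uncurry_left
      calc ∫⁻ y in Metric.ball x ε, ‖w x - w y‖ₑ
          ≤ ∫⁻ y in Metric.ball x ε, (ENNReal.ofReal τ + C * k x y) := by
            refine setLIntegral_mono' Metric.isOpen_ball.measurableSet fun y hy => ?_
            by_cases hxy : x = y
            · simp [hxy]
            have hr : 0 < ‖x - y‖ := norm_pos_iff.2 (sub_ne_zero.2 hxy)
            have hrε : ‖x - y‖ ≤ ε := by
              rw [← dist_eq_norm, dist_comm]; exact (Metric.mem_ball.1 hy).le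
            have := ENNReal.ofReal_le_ofReal
              (abs_le_add_kernel_mul_rpow hp (d := w x - w y) hps hτ hr hrε)
            rw [ENNReal.ofReal_add hτ.le (by positivity), ENNReal.ofReal_mul (by positivity),
              ENNReal.ofReal_mul (by positivity : 0 ≤ ‖x - y‖ ^ (-κ)),
              ← ENNReal.ofReal_rpow_of_nonneg (abs_nonneg _) (by linarith),
              ← Real.enorm_eq_ofReal_abs] at this
            exact this
        _ = ENNReal.ofReal τ * volume (Metric.ball x ε) +
            C * ∫⁻ y in Metric.ball x ε, k x y := by
            rw [lintegral_add_left measurable_const, setLIntegral_const,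
              lintegral_const_mul _ hkx]
        _ ≤ _ := by
            rw [hvol]
            exact add_le_add le_rfl (mul_le_mul_right (setLIntegral_le_lintegral _ _) _)
    rw [e2, e1, add_comm]
    exact (enorm_add_le _ _).trans
      (add_le_add le_rfl ((enorm_integral_le_lintegral_enorm _).trans e3))
  have hlast : ∫⁻ x in Ω, ∫⁻ y, k x y ≤ ∫⁻ z, ‖diff w z‖ₑ ^ p ∂gagliardoMeasure N s p := by
    have h1 := setLIntegral_gagliardo (s := s) (p := p) (MeasurableSet.univ (α := E N))
      ((measurable_diff hw).enorm.pow_const p)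
    rw [univ_prod_univ, Measure.restrict_univ, Measure.restrict_univ] at h1
    rw [h1]
    exact setLIntegral_le_lintegral _ _
  have hkm1 : Measurable fun x => ∫⁻ y, k x y := hkm.lintegral_prod_right
  calc volume (Metric.ball (0 : E N) ε) * ∫⁻ x in Ω, ‖w x‖ₑ
      = ∫⁻ x in Ω, volume (Metric.ball (0 : E N) ε) * ‖w x‖ₑ :=
        (lintegral_const_mul _ hw.enorm).symm
    _ ≤ ∫⁻ x in Ω, (‖∫ y in Metric.ball x ε, w y‖ₑ +
        (ENNReal.ofReal τ * volume (Metric.ball (0 : E N) ε) + C * ∫⁻ y, k x y)) :=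
        lintegral_mono hpt
    _ = (∫⁻ x in Ω, ‖∫ y in Metric.ball x ε, w y‖ₑ) +
        (ENNReal.ofReal τ * volume (Metric.ball (0 : E N) ε) * volume Ω +
          C * ∫⁻ x in Ω, ∫⁻ y, k x y) := by
        rw [lintegral_add_right _ ((hkm1.const_mul C).const_add _),
          lintegral_add_left measurable_const, setLIntegral_const, lintegral_const_mul _ hkm1]
    _ ≤ _ := add_le_add le_rfl (add_le_add le_rfl (mul_le_mul_right hlast _))

lemma stronglyMeasurable_setIntegral_ball {w : E N → ℝ} (hw : Measurable w) (ε : ℝ) :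
    StronglyMeasurable fun x : E N => ∫ y in Metric.ball x ε, w y := by
  have hm : MeasurableSet {z : E N × E N | dist z.2 z.1 < ε} :=
    measurableSet_lt (measurable_snd.dist measurable_fst) measurable_const
  have h1 : StronglyMeasurable fun z : E N × E N =>
      {z : E N × E N | dist z.2 z.1 < ε}.indicator (fun z => w z.2) z :=
    ((hw.comp measurable_snd).indicator hm).stronglyMeasurable
  have h2 := h1.integral_prod_right' (ν := (volume : Measure (E N)))
  convert h2 using 2 with x
  rw [← integral_indicator Metric.isOpen_ball.measurableSet]
  rfl

/-- Compactness: functions vanishing off a bounded set `Ω`, dominated in `L^2(Ω)` and of bounded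
Gagliardo energy, have a subsequence that converges almost everywhere in `Ω`. -/
lemma exists_subseq_tendsto_ae [NeZero N] (hp : 1 ≤ p) (hs : 0 < s) {Ω : Set (E N)}
    (hΩm : MeasurableSet Ω) (hΩ : Bornology.IsBounded Ω) {u : ℕ → E N → ℝ} {h : E N → ℝ}
    (hu : ∀ n, Measurable (u n)) (hh : MemLp h 2 (volume.restrict Ω))
    (huh : ∀ n, ∀ᵐ x ∂volume.restrict Ω, |u n x| ≤ h x)
    (hu0 : ∀ n, ∀ᵐ x ∂volume.restrict Ωᶜ, u n x = 0) {M : ℝ≥0∞} (hM : M ≠ ∞)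
    (huM : ∀ m n, ∫⁻ z, ‖diff (u m - u n) z‖ₑ ^ p ∂gagliardoMeasure N s p ≤ M) :
    ∃ ns : ℕ → ℕ, StrictMono ns ∧ ∃ g : E N → ℝ,
      ∀ᵐ x ∂volume.restrict Ω, Tendsto (fun k => u (ns k) x) atTop (𝓝 (g x)) := by
  have hΩv : volume Ω ≠ ∞ := hΩ.measure_lt_top.ne
  have : IsFiniteMeasure (volume.restrict Ω) := ⟨by simpa using hΩv.lt_top⟩
  have hN : (0 : ℝ) < N := Nat.cast_pos.2 (NeZero.pos N)
  have hps : 0 ≤ (N : ℝ) + p * s := by positivity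
  have hh1 : Integrable h (volume.restrict Ω) := hh.integrable (by norm_num)
  obtain ⟨ns, hns, hconv⟩ := exists_subseq_tendsto_setIntegral
    (fun n => (hu n).aestronglyMeasurable) hh huh
  have hind : ∀ n, Ω.indicator (u n) =ᵐ[volume] u n := fun n => by
    have h1 := (ae_restrict_iff' hΩm.compl).1 (hu0 n)
    filter_upwards [h1] with x hx
    by_cases hxΩ : x ∈ Ω
    · simp [hxΩ]
    · simp [hxΩ, hx hxΩ]
  have hui : ∀ n, IntegrableOn (u n) Ω := fun n =>
    hh1.mono' (hu n).aestronglyMeasurable (huh n)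
  have hui' : ∀ n, Integrable (u n) := fun n =>
    ((integrable_indicator_iff hΩm).2 (hui n)).congr (hind n)
  -- integrals over balls converge at every centre, hence in `L^1(Ω)`
  have hball : ∀ n x ε, ∫ y in Metric.ball x ε, u n y =
      ∫ y in Metric.ball x ε, u n y ∂volume.restrict Ω := fun n x ε => by
    rw [Measure.restrict_restrict Metric.isOpen_ball.measurableSet,
      ← setIntegral_indicator hΩm]
    exact (integral_congr_ae (ae_restrict_of_ae (hind n))).symm
  have havg : ∀ ε, ∃ L : E N → ℝ, AEStronglyMeasurable L (volume.restrict Ω) ∧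
      Tendsto (fun k => ∫⁻ x in Ω, ENNReal.ofReal ‖(∫ y in Metric.ball x ε, u (ns k) y) - L x‖)
        atTop (𝓝 0) := by
    intro ε
    choose L hL using fun x : E N => hconv (Metric.ball x ε) Metric.isOpen_ball.measurableSet
    have hA : ∀ k, AEStronglyMeasurable (fun x => ∫ y in Metric.ball x ε, u (ns k) y)
        (volume.restrict Ω) := fun k =>
      (stronglyMeasurable_setIntegral_ball (hu (ns k)) ε).aestronglyMeasurable
    have hlim : ∀ x, Tendsto (fun k => ∫ y in Metric.ball x ε, u (ns k) y) atTop (𝓝 (L x)) := by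
      intro x
      simp only [hball]
      exact hL x
    refine ⟨L, aestronglyMeasurable_of_tendsto_ae _ hA (Eventually.of_forall hlim),
      tendsto_lintegral_norm_of_dominated_convergence (bound := fun _ => ∫ y in Ω, h y)
      hA (integrable_const _).2 (fun k => Eventually.of_forall fun x => ?_)
      (Eventually.of_forall hlim)⟩
    rw [hball]
    have hnn : 0 ≤ᵐ[volume.restrict Ω] h := by
      filter_upwards [huh 0] with x hx using (abs_nonneg _).trans hx
    refine (norm_integral_le_of_norm_le hh1.restrict (ae_restrict_of_ae (huh (ns k)))).trans ?_
    exact setIntegral_le_integral hh1 hnn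
  have hCauchy : ∀ η : ℝ≥0∞, 0 < η → ∃ K, ∀ k, K ≤ k → ∀ l, K ≤ l →
      ∫⁻ x in Ω, ‖u (ns k) x - u (ns l) x‖ₑ ≤ η := by
    intro η hη
    obtain ⟨ω, hω, hvol⟩ := exists_volume_ball_eq N
    by_cases hηt : η = ∞
    · exact ⟨0, fun _ _ _ _ => hηt ▸ le_top⟩
    lift η to ℝ≥0 using hηt
    have hη' : (0 : ℝ) < η := by exact_mod_cast hη
    set V := (volume Ω).toReal with hV
    have hV0 : 0 ≤ V := ENNReal.toReal_nonneg
    set m := M.toReal with hm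
    have hm0 : 0 ≤ m := ENNReal.toReal_nonneg
    -- first the truncation level `τ`, then the radius `ε`, then the index `K`
    obtain ⟨τ, hτ, hτV⟩ : ∃ τ : ℝ, 0 < τ ∧ τ * V ≤ η / 4 := by
      refine ⟨η / (4 * (V + 1)), by positivity, ?_⟩
      rw [div_mul_eq_mul_div, div_le_div_iff₀ (by positivity) (by positivity)]
      nlinarith
    obtain ⟨ε, hε, hεm⟩ : ∃ ε : ℝ, 0 < ε ∧ τ ^ (1 - p) * ε ^ (p * s) * m / ω ≤ η / 4 := by
      have hc : Tendsto (fun ε : ℝ => τ ^ (1 - p) * ε ^ (p * s) * m / ω) (𝓝[>] 0)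
          (𝓝 (τ ^ (1 - p) * 0 ^ (p * s) * m / ω)) := by
        have h0 : ContinuousAt (fun ε : ℝ => ε ^ (p * s)) 0 :=
          Real.continuousAt_rpow_const _ _ (Or.inr (by positivity))
        exact (((h0.tendsto.mono_left nhdsWithin_le_nhds).const_mul _).mul_const _).div_const _
      rw [Real.zero_rpow (by positivity), mul_zero, zero_mul, zero_div] at hc
      have := (hc.eventually_le_const (by positivity : (0 : ℝ) < η / 4)).and self_mem_nhdsWithin
      obtain ⟨ε, h1, h2⟩ := this.exists
      exact ⟨ε, h2, h1⟩
    obtain ⟨L, hLm, hL⟩ := havg ε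
    have hδ : (0 : ℝ≥0∞) < ENNReal.ofReal (ω * ε ^ (N : ℝ) * (η / 4)) :=
      ENNReal.ofReal_pos.2 (by positivity)
    obtain ⟨K, hK⟩ := eventually_atTop.1 (hL.eventually_le_const hδ)
    refine ⟨K, fun k hk l hl => ?_⟩
    have key := volume_ball_mul_lintegral_le (s := s) hp hps ((hu (ns k)).sub (hu (ns l)))
      ((hui' (ns k)).sub (hui' (ns l))).locallyIntegrable (Ω := Ω) hε hτ
    have h1 : ∫⁻ x in Ω, ‖∫ y in Metric.ball x ε, (u (ns k) - u (ns l)) y‖ₑ ≤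
        ENNReal.ofReal (ω * ε ^ (N : ℝ) * (η / 4)) +
          ENNReal.ofReal (ω * ε ^ (N : ℝ) * (η / 4)) := by
      refine le_trans ?_ (add_le_add (hK k hk) (hK l hl))
      rw [← lintegral_add_left']
      · refine lintegral_mono fun x => ?_
        simp only [Pi.sub_apply]
        rw [integral_sub (hui' _).integrableOn (hui' _).integrableOn, ofReal_norm, ofReal_norm]
        have : ∀ a b c : ℝ, ‖a - b‖ₑ ≤ ‖a - c‖ₑ + ‖b - c‖ₑ := fun a b c => by
          rw [← sub_sub_sub_cancel_right a b c]
          exact enorm_sub_le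
        exact this _ _ _
      · exact (((stronglyMeasurable_setIntegral_ball (hu (ns k)) ε).aestronglyMeasurable.sub
          hLm).norm.aemeasurable).ennreal_ofReal
    have h2 := key.trans (add_le_add h1 (add_le_add le_rfl (mul_le_mul_right (huM _ _) _)))
    rw [hvol _ hε.le, ← ENNReal.ofReal_toReal hΩv, ← ENNReal.ofReal_toReal hM, ← hV, ← hm,
      ← ENNReal.ofReal_mul hτ.le, ← ENNReal.ofReal_mul (by positivity),
      ← ENNReal.ofReal_mul (by positivity), ← ENNReal.ofReal_add (by positivity) (by positivity),
      ← ENNReal.ofReal_add (by positivity) (by positivity),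
      ← ENNReal.ofReal_add (by positivity) (by positivity)] at h2
    have hpos : 0 < ω * ε ^ (N : ℝ) := by positivity
    rw [mul_comm, ← ENNReal.le_div_iff_mul_le (Or.inl (ENNReal.ofReal_pos.2 hpos).ne') (by simp),
      ← ENNReal.ofReal_div_of_pos hpos] at h2
    refine h2.trans (ENNReal.ofReal_le_of_le_toReal ?_)
    rw [ENNReal.coe_toReal, div_le_iff₀ hpos]
    have e1 : τ ^ (1 - p) * ε ^ ((N : ℝ) + p * s) * m =
        τ ^ (1 - p) * ε ^ (p * s) * m / ω * (ω * ε ^ (N : ℝ)) := by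
      rw [Real.rpow_add hε]; field_simp
    have e2 := mul_le_mul_of_nonneg_right hεm hpos.le
    have e3 := mul_le_mul_of_nonneg_right hτV hpos.le
    rw [e1]
    linarith
  have hmem : ∀ k, MemLp (u (ns k)) 1 (volume.restrict Ω) := fun k =>
    memLp_one_iff_integrable.2 (hui (ns k))
  have hC : CauchySeq fun k => (hmem k).toLp := by
    rw [EMetric.cauchySeq_iff]
    intro η hη
    obtain ⟨η', h0, h1⟩ := exists_between hη
    obtain ⟨K, hK⟩ := hCauchy η' h0
    refine ⟨K, fun k hk l hl => ?_⟩
    rw [Lp.edist_toLp_toLp, eLpNorm_one_eq_lintegral_enorm]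
    exact (hK k hk l hl).trans_lt h1
  obtain ⟨G, hG⟩ := cauchySeq_tendsto_of_complete hC
  obtain ⟨ms, hms, hae⟩ := (tendstoInMeasure_of_tendsto_Lp hG).exists_seq_tendsto_ae
  refine ⟨ns ∘ ms, hns.comp hms, G, ?_⟩
  filter_upwards [hae, ae_all_iff.2 fun k => (hmem k).coeFn_toLp] with x hx h1
  simp only [h1] at hx
  exact hx

/-! ### The space `W^{s,p}_0(Ω)` -/

namespace W0

variable {N : ℕ} {s p : ℝ} {Ω : Set (E N)}

lemma memLp_diff (u : W0 Ω s p) : MemLp (diff u) (ENNReal.ofReal p) (gagliardoMeasure N s p) :=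
  u.2.1

lemma ae_eq_zero (u : W0 Ω s p) : ∀ᵐ x ∂volume.restrict Ωᶜ, u x = 0 := u.2.2

lemma measurable (u : W0 Ω s p) : Measurable u := (Lp.stronglyMeasurable u.1).measurable

lemma coe_sub (u v : W0 Ω s p) : ⇑(u - v) =ᵐ[volume] ⇑u - ⇑v := Lp.coeFn_sub u.1 v.1

lemma diff_sub (u v : W0 Ω s p) :
    diff ⇑(u - v) =ᵐ[gagliardoMeasure N s p] diff ⇑u - diff ⇑v := by
  refine (diff_congr s p (coe_sub u v)).trans (EventuallyEq.of_eq ?_)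
  ext z; simp [diff]; ring

lemma memW_univ (u : W0 Ω s p) : MemW s p univ u := by
  refine ⟨?_, ?_⟩
  · rw [Measure.restrict_univ]; exact Lp.memLp u.1
  · rw [univ_prod_univ, Measure.restrict_univ]; exact u.2.1

variable [Fact (1 < N)] [hp : Fact (2 ≤ p)]

lemma eLpNorm_diff (u : W0 Ω s p) :
    eLpNorm (diff u) (ENNReal.ofReal p) (gagliardoMeasure N s p) = ENNReal.ofReal ‖u‖ := by
  rw [norm_def, ENNReal.ofReal_toReal u.memLp_diff.2.ne]

lemma eLpNorm_diff_sub (u v : W0 Ω s p) :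
    eLpNorm (diff u - diff v) (ENNReal.ofReal p) (gagliardoMeasure N s p) =
      ENNReal.ofReal ‖u - v‖ := by
  rw [← eLpNorm_congr_ae (diff_sub u v), eLpNorm_diff]

lemma lintegral_diff_sub (u v : W0 Ω s p) :
    ∫⁻ z, ‖diff (⇑u - ⇑v) z‖ₑ ^ p ∂gagliardoMeasure N s p = ENNReal.ofReal (‖u - v‖ ^ p) := by
  have hp0 : 0 < p := by linarith [hp.out]
  have e : diff (⇑u - ⇑v) = diff ⇑u - diff ⇑v := by ext z; simp [diff]; ring
  rw [e, ← ENNReal.ofReal_rpow_of_nonneg (norm_nonneg _) hp0.le, ← eLpNorm_diff_sub,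
    eLpNorm_eq_lintegral_rpow_enorm_toReal (by simpa using hp0) ENNReal.ofReal_ne_top,
    ENNReal.toReal_ofReal hp0.le, ← ENNReal.rpow_mul, one_div, inv_mul_cancel₀ hp0.ne',
    ENNReal.rpow_one]

lemma pairing_self (u : W0 Ω s p) : pairing s p u u = ‖u‖ ^ p := by
  rw [norm_def, ← integral_abs_rpow hp.out u.memLp_diff]
  refine integral_congr_ae (Eventually.of_forall fun z => ?_)
  have h2 := hp.out
  change |diff u z| ^ (p - 2) * diff u z * diff u z = _
  rw [mul_assoc, ← abs_mul_abs_self (diff u z), ← mul_assoc,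
    ← Real.rpow_add_one' (abs_nonneg _) (by linarith),
    ← Real.rpow_add_one' (abs_nonneg _) (by linarith)]
  congr 1; ring

/-- Strong monotonicity of the fractional `p`-Laplacian. -/
lemma norm_sub_rpow_le (u v : W0 Ω s p) :
    ‖u - v‖ ^ p ≤ 2 ^ (p - 1) * (pairing s p u ⇑(u - v) - pairing s p v ⇑(u - v)) := by
  have hC : (0 : ℝ) < 2 ^ (p - 1) := by positivity
  rw [← inv_mul_le_iff₀ hC, norm_def, ← integral_abs_rpow hp.out (u - v).memLp_diff,
    ← integral_const_mul]
  have i1 := integrable_abs_rpow_mul hp.out u.memLp_diff (u - v).memLp_diff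
  have i2 := integrable_abs_rpow_mul hp.out v.memLp_diff (u - v).memLp_diff
  have e : pairing s p u ⇑(u - v) - pairing s p v ⇑(u - v) =
      ∫ z, (|diff u z| ^ (p - 2) * diff u z * diff ⇑(u - v) z -
        |diff v z| ^ (p - 2) * diff v z * diff ⇑(u - v) z) ∂gagliardoMeasure N s p :=
    (integral_sub i1 i2).symm
  rw [e]
  refine integral_mono_ae ((integrable_abs_rpow hp.out (u - v).memLp_diff).const_mul _)
    (i1.sub i2) ?_
  filter_upwards [diff_sub u v] with z hz
  rw [hz, Pi.sub_apply, ← sub_mul]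
  exact mul_abs_sub_rpow_le hp.out _ _

lemma tendsto_pairing {v : ℕ → W0 Ω s p} {w : W0 Ω s p} (h : Tendsto v atTop (𝓝 w))
    (φ : W0 Ω s p) : Tendsto (fun n => pairing s p (v n) φ) atTop (𝓝 (pairing s p w φ)) := by
  refine tendsto_integral_abs_rpow_mul hp.out (fun n => (v n).memLp_diff) w.memLp_diff
    φ.memLp_diff ?_
  have := ENNReal.tendsto_ofReal (tendsto_iff_norm_sub_tendsto_zero.1 h)
  rw [ENNReal.ofReal_zero] at this
  exact this.congr fun n => (eLpNorm_diff_sub _ _).symm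

/-- Cauchy sequences for `‖·‖_{s,p}` converge as soon as they converge almost everywhere to a
function in `L^p`. -/
lemma exists_tendsto_of_cauchySeq {v : ℕ → W0 Ω s p} (hv : CauchySeq v) {g : E N → ℝ}
    (hg : MemLp g (ENNReal.ofReal p) volume)
    (hvg : ∀ᵐ x, Tendsto (fun k => v k x) atTop (𝓝 (g x))) :
    ∃ w : W0 Ω s p, ⇑w =ᵐ[volume] g ∧ Tendsto v atTop (𝓝 w) := by
  have hiso : ∀ a b : W0 Ω s p, dist (toLp a) (toLp b) = dist a b := fun a b => by
    rw [dist_eq_norm, dist_eq_norm, ← map_sub]; rfl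
  have hC : CauchySeq fun k => toLp (v k) := by
    rw [Metric.cauchySeq_iff] at hv ⊢
    simpa only [hiso] using hv
  obtain ⟨F, hF⟩ := cauchySeq_tendsto_of_complete hC
  obtain ⟨ms, hms, hae⟩ := (tendstoInMeasure_of_tendsto_Lp hF).exists_seq_tendsto_ae
  have hdiff : ∀ᵐ z ∂gagliardoMeasure N s p,
      Tendsto (fun k => diff (v k) z) atTop (𝓝 (diff g z)) := by
    refine (withDensity_absolutelyContinuous _ _).ae_le ?_
    have h1 := Measure.quasiMeasurePreserving_fst (μ := (volume : Measure (E N)))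
      (ν := (volume : Measure (E N))).ae hvg
    have h2 := Measure.quasiMeasurePreserving_snd (μ := (volume : Measure (E N)))
      (ν := (volume : Measure (E N))).ae hvg
    filter_upwards [h1, h2] with z hz1 hz2
    exact hz1.sub hz2
  have hFg : F =ᵐ[gagliardoMeasure N s p] diff g := by
    filter_upwards [hae, hdiff, ae_all_iff.2 fun k => (v k).memLp_diff.coeFn_toLp] with z h1 h2 h3
    refine tendsto_nhds_unique (h1.congr fun k => ?_) (h2.comp hms.tendsto_atTop)
    exact h3 (ms k)
  have hgF : diff hg.toLp =ᵐ[gagliardoMeasure N s p] F :=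
    (diff_congr s p hg.coeFn_toLp).trans hFg.symm
  let w : W0 Ω s p := ⟨hg.toLp, (Lp.memLp F).ae_eq hgF.symm, by
    filter_upwards [ae_restrict_of_ae hvg, ae_restrict_of_ae hg.coeFn_toLp,
      ae_all_iff.2 fun k => (v k).ae_eq_zero] with x h1 h2 h3
    rw [h2]
    simp only [h3] at h1
    exact tendsto_nhds_unique h1 tendsto_const_nhds⟩
  refine ⟨w, hg.coeFn_toLp, ?_⟩
  have hw : toLp w = F := Lp.ext (w.memLp_diff.coeFn_toLp.trans hgF)
  rw [tendsto_iff_dist_tendsto_zero] at hF ⊢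
  simpa only [← hw, hiso] using hF

end W0

/-! ### Compactness of the solution set -/
/-- The functions between a sub- and a supersolution have a common majorant `h` in `L^q(Ω)`, with
`q` the growth exponent of `f`, and the reaction terms `f(x, u)` have a common majorant `G` which is
integrable against `h` and against every element of `W^{s,p}_0(Ω)`. -/
lemma IsSubSuperPair.exists_dominating [hN1 : Fact (1 < N)] [hp : Fact (2 ≤ p)] (hs : 0 < s)
    (hN : p * s < N) {Ω : Set (E N)} (hΩ : Bornology.IsBounded Ω) {f : E N → ℝ → ℝ}
    (hf : H0 Ω s p f) {lo hi : E N → ℝ} (hpair : IsSubSuperPair Ω s p f lo hi) :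
    ∃ h G : E N → ℝ, MemLp h (ENNReal.ofReal p) (volume.restrict Ω) ∧
      MemLp h 2 (volume.restrict Ω) ∧
      (∀ u : E N → ℝ, (∀ᵐ x ∂volume.restrict Ω, lo x ≤ u x ∧ u x ≤ hi x) →
        ∀ᵐ x ∂volume.restrict Ω, |u x| ≤ h x ∧ |f x (u x)| ≤ G x) ∧
      AEStronglyMeasurable G (volume.restrict Ω) ∧ (∀ x, 0 ≤ G x) ∧
      IntegrableOn (fun x => G x * h x) Ω ∧
      ∀ v : W0 Ω s p, IntegrableOn (fun x => G x * v x) Ω := by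
  have hp2 := hp.out
  have hN0 : NeZero N := ⟨by have := hN1.out; omega⟩
  obtain ⟨c₀, q, hc₀, hpq, hq, hgrowth⟩ := hf.growth
  have hfin : IsFiniteMeasure (volume.restrict Ω) := ⟨by simpa using hΩ.measure_lt_top⟩
  have hemb : ∀ {U : Set (E N)} {u : E N → ℝ}, IsOpen U → closure Ω ⊆ U → MemW s p U u →
      MemLp u (ENNReal.ofReal q) (volume.restrict Ω) := fun hU hΩU hu =>
    hu.memLp (by linarith) hs hN hΩ hU hΩU (by linarith) hq
  obtain ⟨U₁, hU₁, hΩU₁, hlo⟩ := hpair.sub.memWTilde.exists_memW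
  obtain ⟨U₂, hU₂, hΩU₂, hhi⟩ := hpair.super.memWTilde.exists_memW
  set h : E N → ℝ := fun x => |lo x| + |hi x| with hh
  have hhq : MemLp h (ENNReal.ofReal q) (volume.restrict Ω) :=
    (hemb hU₁ hΩU₁ hlo).norm.add (hemb hU₂ hΩU₂ hhi).norm
  have hh0 : ∀ x, 0 ≤ h x := fun x => by positivity
  have hGint : ∀ v : E N → ℝ, MemLp v (ENNReal.ofReal q) (volume.restrict Ω) →
      IntegrableOn (fun x => c₀ * (1 + h x ^ (q - 1)) * v x) Ω := by
    intro v hv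
    have hv1 : Integrable v (volume.restrict Ω) :=
      hv.integrable (by rw [ENNReal.one_le_ofReal]; linarith)
    have h1 := integrable_abs_rpow_mul (by linarith : 2 ≤ q) hhq hv
    refine ((hv1.add h1).const_mul c₀).congr (Eventually.of_forall fun x => ?_)
    simp only [Pi.add_apply]
    rw [abs_rpow_sub_two_mul_self (by linarith) (hh0 x)]
    ring
  refine ⟨h, fun x => c₀ * (1 + h x ^ (q - 1)), ?_, ?_, ?_, ?_, ?_, hGint h hhq, fun v => ?_⟩
  · exact hhq.mono_exponent (ENNReal.ofReal_le_ofReal hpq.le)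
  · refine hhq.mono_exponent ?_
    rw [← ENNReal.ofReal_ofNat]
    exact ENNReal.ofReal_le_ofReal (by linarith)
  · intro u hu
    filter_upwards [hu, hgrowth] with x hx hfx
    have hux : |u x| ≤ h x := by
      have h1 := neg_abs_le (lo x)
      have h2 := le_abs_self (hi x)
      have h3 := abs_nonneg (lo x)
      have h4 := abs_nonneg (hi x)
      rw [hh, abs_le]
      constructor <;> linarith [hx.1, hx.2]
    refine ⟨hux, (hfx _).trans ?_⟩
    have : |u x| ^ (q - 1) ≤ h x ^ (q - 1) :=
      Real.rpow_le_rpow (abs_nonneg _) hux (by linarith)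
    gcongr
  · exact (((hhq.1.aemeasurable.pow_const _).const_add 1).const_mul c₀).aestronglyMeasurable
  · intro x
    have := hh0 x
    positivity
  · exact hGint v (hemb isOpen_univ (subset_univ _) v.memW_univ)

theorem isCompact_solutionSet [Fact (1 < N)] [Fact (2 ≤ p)] (hs : 0 < s) (hN : p * s < N)
    {Ω : Set (E N)} (hΩo : IsOpen Ω) (hΩb : Bornology.IsBounded Ω) {f : E N → ℝ → ℝ}
    (hf : H0 Ω s p f) {lo hi : E N → ℝ} (hpair : IsSubSuperPair Ω s p f lo hi) :
    IsCompact (solutionSet Ω s p f lo hi) := by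
  have hp2 : (2 : ℝ) ≤ p := Fact.out
  have hp0 : 0 < p := by linarith
  have : NeZero N := ⟨by have : 1 < N := Fact.out; omega⟩
  obtain ⟨h, G, hhp, hh2, hdom, hGm, hG0, hGh, hGv⟩ := hpair.exists_dominating hs hN hΩb hf
  have hΩm := hΩo.measurableSet
  have hfm : ∀ u : W0 Ω s p, AEMeasurable (fun x => f x (u x)) (volume.restrict Ω) := fun u =>
    aemeasurable_caratheodory hf.measurable hf.continuous u.measurable.aemeasurable
  have hfint : ∀ u ∈ solutionSet Ω s p f lo hi, ∀ v : W0 Ω s p,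
      IntegrableOn (fun x => f x (u x) * v x) Ω := by
    intro u hu v
    refine Integrable.mono (hGv v) ((hfm u).mul v.measurable.aemeasurable).aestronglyMeasurable ?_
    filter_upwards [hdom u hu.2] with x hx
    rw [norm_mul, norm_mul]
    exact mul_le_mul_of_nonneg_right (hx.2.trans (le_abs_self _)) (norm_nonneg _)
  -- the solution set is bounded
  set M := ∫ x in Ω, G x * h x with hM
  have hbdd : ∀ u ∈ solutionSet Ω s p f lo hi, ‖u‖ ^ p ≤ M := by
    intro u hu
    rw [← W0.pairing_self, hu.1 u]
    refine integral_mono_ae (hfint u hu u) hGh ?_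
    filter_upwards [hdom u hu.2] with x hx
    refine (le_abs_self _).trans ?_
    rw [abs_mul]
    exact mul_le_mul hx.2 hx.1 (abs_nonneg _) (hG0 x)
  have hM0 : 0 ≤ M := by
    rw [hM]
    refine integral_nonneg_of_ae ?_
    filter_upwards [hdom lo (by filter_upwards [hpair.le] with x hx using ⟨le_rfl, hx⟩)] with x hx
    exact mul_nonneg (hG0 x) ((abs_nonneg _).trans hx.1)
  have hnorm : ∀ u ∈ solutionSet Ω s p f lo hi, ‖u‖ ≤ M ^ p⁻¹ := fun u hu =>
    (Real.le_rpow_inv_iff_of_pos (norm_nonneg _) hM0 hp0).2 (hbdd u hu)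
  refine IsSeqCompact.isCompact fun u hu => ?_
  obtain ⟨ns, hns, g₀, hg₀⟩ := exists_subseq_tendsto_ae (s := s) (by linarith : 1 ≤ p) hs hΩm hΩb
    (fun n => (u n).measurable) hh2
    (fun n => (hdom (u n) (hu n).2).mono fun x hx => hx.1) (fun n => (u n).ae_eq_zero)
    (M := ENNReal.ofReal ((M ^ p⁻¹ + M ^ p⁻¹) ^ p)) ENNReal.ofReal_ne_top (fun m n => by
      rw [W0.lintegral_diff_sub]
      refine ENNReal.ofReal_le_ofReal (Real.rpow_le_rpow (norm_nonneg _) ?_ hp0.le)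
      exact (norm_sub_le _ _).trans (add_le_add (hnorm _ (hu m)) (hnorm _ (hu n))))
  set v := fun k => u (ns k) with hv
  have hvS : ∀ k, v k ∈ solutionSet Ω s p f lo hi := fun k => hu (ns k)
  have hvdom : ∀ k, ∀ᵐ x ∂volume.restrict Ω, |v k x| ≤ h x ∧ |f x (v k x)| ≤ G x := fun k =>
    hdom (v k) (hvS k).2
  have hgh : ∀ᵐ x ∂volume.restrict Ω, |g₀ x| ≤ h x := by
    filter_upwards [hg₀, ae_all_iff.2 hvdom] with x h1 h2
    exact le_of_tendsto h1.abs (Eventually.of_forall fun k => (h2 k).1)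
  have hgm : AEStronglyMeasurable g₀ (volume.restrict Ω) :=
    aestronglyMeasurable_of_tendsto_ae _ (fun k => (v k).measurable.aestronglyMeasurable) hg₀
  have hbound : ∀ k, ∀ᵐ x ∂volume.restrict Ω, ‖G x * |v k x - g₀ x|‖ ≤ 2 * (G x * h x) := by
    intro k
    filter_upwards [hvdom k, hgh] with x h1 h2
    rw [Real.norm_eq_abs, abs_mul, abs_abs, abs_of_nonneg (hG0 x)]
    have h3 : |v k x - g₀ x| ≤ 2 * h x := (abs_sub _ _).trans (by linarith [h1.1])
    have := mul_le_mul_of_nonneg_left h3 (hG0 x)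
    linarith
  have hmeas : ∀ k, AEStronglyMeasurable (fun x => G x * |v k x - g₀ x|) (volume.restrict Ω) :=
    fun k => hGm.mul ((v k).measurable.aestronglyMeasurable.sub hgm).norm
  have hint : ∀ k, IntegrableOn (fun x => G x * |v k x - g₀ x|) Ω := fun k =>
    Integrable.mono' (hGh.const_mul 2) (hmeas k) (hbound k)
  -- `v` is Cauchy, by strong monotonicity and dominated convergence
  have hlim : Tendsto (fun k => ∫ x in Ω, G x * |v k x - g₀ x|) atTop (𝓝 0) := by
    have h1 := tendsto_integral_of_dominated_convergence (μ := volume.restrict Ω)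
      (F := fun k x => G x * |v k x - g₀ x|) (f := fun _ => (0 : ℝ))
      (fun x => 2 * (G x * h x))
      hmeas (hGh.const_mul 2) hbound ?_
    · simpa using h1
    · filter_upwards [hg₀] with x hx
      have h1 : Tendsto (fun k => G x * |v k x - g₀ x|) atTop (𝓝 (G x * |g₀ x - g₀ x|)) :=
        ((hx.sub_const _).abs).const_mul _
      simpa using h1
  have hkey : ∀ k l, ‖v k - v l‖ ^ p ≤ 2 ^ (p - 1) *
      (2 * ((∫ x in Ω, G x * |v k x - g₀ x|) + ∫ x in Ω, G x * |v l x - g₀ x|)) := by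
    intro k l
    refine (W0.norm_sub_rpow_le (v k) (v l)).trans ?_
    refine mul_le_mul_of_nonneg_left ?_ (by positivity)
    rw [(hvS k).1, (hvS l).1, ← integral_sub (hfint _ (hvS k) _) (hfint _ (hvS l) _),
      ← integral_add (hint k) (hint l), ← integral_const_mul]
    refine integral_mono_ae ((hfint _ (hvS k) _).sub (hfint _ (hvS l) _))
      (((hint k).add (hint l)).const_mul 2) ?_
    filter_upwards [hvdom k, hvdom l, ae_restrict_of_ae (W0.coe_sub (v k) (v l))] with x h1 h2 h3
    rw [h3, Pi.sub_apply, ← sub_mul]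
    refine (le_abs_self _).trans ?_
    rw [abs_mul]
    have h4 : |f x (v k x) - f x (v l x)| ≤ 2 * G x :=
      (abs_sub _ _).trans (by linarith [h1.2, h2.2])
    have h5 : |v k x - v l x| ≤ |v k x - g₀ x| + |v l x - g₀ x| := by
      rw [← sub_sub_sub_cancel_right (v k x) (v l x) (g₀ x)]
      exact abs_sub _ _
    calc _ ≤ 2 * G x * (|v k x - g₀ x| + |v l x - g₀ x|) :=
          mul_le_mul h4 h5 (abs_nonneg _) (by linarith [hG0 x])
      _ = _ := by ring
  have hCauchy : CauchySeq v := by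
    rw [Metric.cauchySeq_iff]
    intro ε hε
    have hδ : 0 < ε ^ p / (2 ^ (p - 1) * 4) := by positivity
    obtain ⟨K, hK⟩ := eventually_atTop.1 (hlim.eventually_lt_const hδ)
    refine ⟨K, fun k hk l hl => ?_⟩
    rw [dist_eq_norm, ← Real.rpow_lt_rpow_iff (norm_nonneg _) hε.le hp0]
    refine (hkey k l).trans_lt ?_
    have h1 := hK k hk
    have h2 := hK l hl
    rw [lt_div_iff₀ (by positivity)] at h1 h2
    linarith
  -- identification of the limit
  have hvg : ∀ᵐ x, Tendsto (fun k => v k x) atTop (𝓝 (Ω.indicator g₀ x)) := by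
    have h0 : ∀ᵐ x, ∀ k, x ∈ Ωᶜ → v k x = 0 :=
      ae_all_iff.2 fun k => (ae_restrict_iff' hΩm.compl).1 (v k).ae_eq_zero
    filter_upwards [(ae_restrict_iff' hΩm).1 hg₀, h0] with x h1 h2
    by_cases hx : x ∈ Ω
    · rw [indicator_of_mem hx]; exact h1 hx
    · rw [indicator_of_notMem hx]
      exact tendsto_const_nhds.congr fun k => (h2 k hx).symm
  have hgp : MemLp (Ω.indicator g₀) (ENNReal.ofReal p) volume :=
    (memLp_indicator_iff_restrict hΩm).2 (hhp.mono' hgm hgh)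
  obtain ⟨w, hwg, hvw⟩ := W0.exists_tendsto_of_cauchySeq hCauchy hgp hvg
  have hae : ∀ᵐ x ∂volume.restrict Ω, Tendsto (fun k => v k x) atTop (𝓝 (w x)) := by
    refine ae_restrict_of_ae ?_
    filter_upwards [hvg, hwg] with x h1 h2
    rwa [h2]
  refine ⟨w, ⟨fun φ => ?_, ?_⟩, ns, hns, hvw⟩
  · refine tendsto_nhds_unique (W0.tendsto_pairing hvw φ) ?_
    simp only [fun k => (hvS k).1 φ]
    refine tendsto_integral_of_dominated_convergence (fun x => ‖G x * φ x‖)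
      (fun k => (hfint _ (hvS k) φ).aestronglyMeasurable) (hGv φ).norm (fun k => ?_) ?_
    · filter_upwards [hvdom k] with x hx
      rw [norm_mul, norm_mul]
      exact mul_le_mul_of_nonneg_right (hx.2.trans (le_abs_self _)) (norm_nonneg _)
    · filter_upwards [hae, hf.continuous] with x h1 h2
      exact ((h2.tendsto _).comp h1).mul_const _
  · filter_upwards [hae, ae_all_iff.2 fun k => (hvS k).2] with x h1 h2
    exact ⟨ge_of_tendsto h1 (Eventually.of_forall fun k => (h2 k).1),
      le_of_tendsto h1 (Eventually.of_forall fun k => (h2 k).2)⟩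

end FracPLap

theorem lemma3p4 {N : ℕ} [Fact (1 < N)] {s p : ℝ} [Fact (2 ≤ p)]
    (hs : 0 < s) (hs1 : s < 1) (hN : p * s < (N : ℝ))
    (Ω : Set (FracPLap.E N)) (hΩo : IsOpen Ω) (hΩc : IsConnected Ω)
    (hΩb : Bornology.IsBounded Ω) (hΩr : FracPLap.HasC11Boundary Ω)
    (f : FracPLap.E N → ℝ → ℝ) (hf : FracPLap.H0 Ω s p f)
    (lo hi : FracPLap.E N → ℝ) (hpair : FracPLap.IsSubSuperPair Ω s p f lo hi) :
    IsCompact (FracPLap.solutionSet Ω s p f lo hi) :=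
  FracPLap.isCompact_solutionSet hs hN hΩo hΩb hf hpair
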